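/- **Conventions.** A *proximate order* for the order $\rho>0$ is a differentiable function $\varrho:[0,\infty)\to[0,\infty)$ with $\lim_{r\to\infty}\varrho(r)=\rho$ and $\lim_{r\to\infty}\varrho'(r)\,r\ln r=0$. A *normalization* of $\varrho$ is a proximate order $\hat\varrho$ for $\rho$ such that $\hat\varrho(r)=\varrho(r)$ for all $r\ge r_1$, for some $r_1>0$, and such that $r\mapsto r^{\hat\varrho(r)}$ is strictly increasing on $(0,\infty)$ and maps $(0,\infty)$ onto $(0,\infty)$. Let $\varphi:(0,\infty)\to(0,\infty)$ be the inverse of this map, and put $$G_{\hat\varrho,q}=\frac{\varphi(q)^q}{(\mathrm e\rho)^{q/\rho}}\quad(q\ge 1),\qquad G_{\hat\varrho,0}=1 .$$ For an entire function $f$ on $\mathbb C^n$ and $\sigma>0$ let $$\|f\|_{\varrho,\sigma}=\sup_{z\in\mathbb C^n}|f(z)|\exp\bigl(-\sigma|z|^{\varrho(|z|)}\bigr)\in[0,\infty],$$ where $|z|$ is the Euclidean norm, and let $A_{\varrho,\sigma}$ be the space of entire $f$ with $\|f\|_{\varrho,\sigma}<\infty$. Put $A_{\varrho}=\bigcup_{\sigma>0}A_{\varrho,\sigma}$,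 and let $A_{\varrho,+0}=\bigcap_{\varepsilon>0}A_{\varrho,\varepsilon}$ carry the projective limit topology, i.e. the locally convex topology defined by the norms $\|\cdot\|_{\varrho,\varepsilon}$, $\varepsilon>0$. **Theorem.** Let $\varrho_1,\varrho_2$ be proximate orders for orders $\rho_1,\rho_2>0$ with $r^{\varrho_1(r)}=O(r^{\varrho_2(r)})$ as $r\to\infty$, and let $\hat\varrho_1$ be any normalization of $\varrho_1$. Let $\boldsymbol D_{\varrho_1\to\varrho_2,0}$ be the set of all formal differential operators $P=\sum_{\alpha\in\mathbb N^n}a_\alpha(z)\partial_z^\alpha$ with coefficients $a_\alpha\in A_{\varrho_2}$ such that $$\forall\sigma>0\ \exists\lambda>0\ \exists C>0\ \forall\alpha\in\mathbb N^n:\quad \|a_\alpha\|_{\varrho_2,\sigma}\le C\,\frac{G_{\hat\varrho_1,|\alpha|}}{\alpha!}\,\lambda^{|\alpha|}.$$ (i) Let $P=\sum_\alpha a_\alpha\partial_z^\alpha\in\boldsymbol D_{\varrho_1\to\varrho_2,0}$. For every $f\in A_{\varrho_1,+0}$ all the terms $a_\alpha\partial_z^\alpha f$ lie in $A_{\varrho_2,+0}$,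 the series $Pf:=\sum_\alpha a_\alpha\partial_z^\alpha f$ converges unconditionally in $A_{\varrho_2,+0}$, and $f\mapsto Pf$ is a continuous linear map $A_{\varrho_1,+0}\to A_{\varrho_2,+0}$. (ii) For every continuous linear map $F:A_{\varrho_1,+0}\to A_{\varrho_2,+0}$ there is a unique $P\in\boldsymbol D_{\varrho_1\to\varrho_2,0}$ such that $Ff=Pf$ for all $f\in A_{\varrho_1,+0}$. -/

import Mathlib

open Filter Topology
open scoped ENNReal

noncomputable section

namespace EntireGrowth

/-! ### Proximate orders -/

/-- `p` is a proximate order for the order `ρ`: a differentiable function `p ≥ 0` on `[0, ∞)` with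
`p(r) → ρ` and `p'(r) r ln r → 0` as `r → ∞`. (Values of `p` at negative arguments play no role.) -/
structure IsProximateOrder (p : ℝ → ℝ) (ρ : ℝ) : Prop where
  differentiableOn : DifferentiableOn ℝ p (Set.Ici 0)
  nonneg : ∀ r, 0 ≤ r → 0 ≤ p r
  tendsto : Tendsto p atTop (𝓝 ρ)
  tendsto_deriv : Tendsto (fun r => deriv p r * r * Real.log r) atTop (𝓝 0)

/-- `q` is a normalization of the proximate order `p` (for the order `ρ`): a proximate order that
agrees with `p` for large `r` and such that `r ↦ r ^ q(r)` is strictly increasing on `(0, ∞)` and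
maps `(0, ∞)` onto `(0, ∞)`. -/
structure IsNormalization (q p : ℝ → ℝ) (ρ : ℝ) : Prop where
  isProximateOrder : IsProximateOrder q ρ
  eventually_eq : ∃ r₁ : ℝ, 0 < r₁ ∧ ∀ r, r₁ ≤ r → q r = p r
  strictMonoOn : StrictMonoOn (fun r : ℝ => r ^ q r) (Set.Ioi 0)
  image_eq : (fun r : ℝ => r ^ q r) '' Set.Ioi 0 = Set.Ioi 0

/-- For a normalized proximate order `q`, the inverse function `φ` on `(0, ∞)` of
`r ↦ r ^ q(r)`, `r > 0`. -/
def phi (q : ℝ → ℝ) : ℝ → ℝ :=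
  Function.invFunOn (fun r : ℝ => r ^ q r) (Set.Ioi 0)

/-- The numbers `G_k = φ(k)^k / (e ρ)^(k/ρ)`, where `φ` belongs to the normalized proximate order
`q` for the order `ρ`; in particular `G_0 = 1`. -/
def G (q : ℝ → ℝ) (ρ : ℝ) (k : ℕ) : ℝ :=
  phi q k ^ k / (Real.exp 1 * ρ) ^ ((k : ℝ) / ρ)

/-! ### Entire functions with growth given by a proximate order -/

/-- `ℂⁿ` with the Euclidean norm. -/
abbrev Cn (n : ℕ) : Type := EuclideanSpace ℂ (Fin n)

/-- `‖f‖_{p,σ} = sup_z |f(z)| exp(-σ |z|^{p(|z|)})`, as an element of `[0, ∞]`. -/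
def growthNorm {n : ℕ} (p : ℝ → ℝ) (σ : ℝ) (f : Cn n → ℂ) : ℝ≥0∞ :=
  ⨆ z : Cn n, ‖f z‖ₑ * ENNReal.ofReal (Real.exp (-(σ * ‖z‖ ^ p ‖z‖)))

theorem growthNorm_zero {n : ℕ} (p : ℝ → ℝ) (σ : ℝ) :
    growthNorm p σ (0 : Cn n → ℂ) = 0 := by
  simp [growthNorm]

theorem growthNorm_add_le {n : ℕ} (p : ℝ → ℝ) (σ : ℝ) (f g : Cn n → ℂ) :
    growthNorm p σ (f + g) ≤ growthNorm p σ f + growthNorm p σ g := by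
  refine iSup_le fun z => ?_
  calc ‖(f + g) z‖ₑ * ENNReal.ofReal (Real.exp (-(σ * ‖z‖ ^ p ‖z‖)))
      ≤ (‖f z‖ₑ + ‖g z‖ₑ) * ENNReal.ofReal (Real.exp (-(σ * ‖z‖ ^ p ‖z‖))) := by
        gcongr
        exact enorm_add_le _ _
    _ = ‖f z‖ₑ * ENNReal.ofReal (Real.exp (-(σ * ‖z‖ ^ p ‖z‖)))
        + ‖g z‖ₑ * ENNReal.ofReal (Real.exp (-(σ * ‖z‖ ^ p ‖z‖))) := add_mul _ _ _
    _ ≤ growthNorm p σ f + growthNorm p σ g :=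
        add_le_add (le_iSup (fun z : Cn n =>
            ‖f z‖ₑ * ENNReal.ofReal (Real.exp (-(σ * ‖z‖ ^ p ‖z‖)))) z)
          (le_iSup (fun z : Cn n =>
            ‖g z‖ₑ * ENNReal.ofReal (Real.exp (-(σ * ‖z‖ ^ p ‖z‖)))) z)

theorem growthNorm_smul {n : ℕ} (p : ℝ → ℝ) (σ : ℝ) (c : ℂ) (f : Cn n → ℂ) :
    growthNorm p σ (c • f) = ‖c‖ₑ * growthNorm p σ f := by
  simp only [growthNorm, ENNReal.mul_iSup, Pi.smul_apply, smul_eq_mul, enorm_mul, mul_assoc]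

/-- The space `A_{p,σ}` of entire functions `f` on `ℂⁿ` with `‖f‖_{p,σ} < ∞`. -/
def growthSpace (n : ℕ) (p : ℝ → ℝ) (σ : ℝ) : Submodule ℂ (Cn n → ℂ) where
  carrier := {f | Differentiable ℂ f ∧ growthNorm p σ f < ∞}
  add_mem' {f g} hf hg := ⟨hf.1.add hg.1,
    (growthNorm_add_le p σ f g).trans_lt (ENNReal.add_lt_top.2 ⟨hf.2, hg.2⟩)⟩
  zero_mem' := ⟨differentiable_const 0, by rw [growthNorm_zero]; exact ENNReal.zero_lt_top⟩
  smul_mem' c f hf := ⟨hf.1.const_smul c, by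
    rw [growthNorm_smul]; exact ENNReal.mul_lt_top enorm_lt_top hf.2⟩

/-- The set of entire functions of at most normal type, `A_p = ⋃_{σ>0} A_{p,σ}`. -/
def normalType (n : ℕ) (p : ℝ → ℝ) : Set (Cn n → ℂ) :=
  {f | ∃ σ : ℝ, 0 < σ ∧ f ∈ growthSpace n p σ}

/-- The space `A_{p,+0}` of entire functions of at most minimal type, the projective limit of the
`A_{p,ε}`, `ε > 0`, along the inclusions, that is, their intersection. It is a type of its own, so
that it does not carry the topology of pointwise convergence. -/
def MinimalType (n : ℕ) (p : ℝ → ℝ) : Type :=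
  ↥(⨅ ε : Set.Ioi (0 : ℝ), growthSpace n p ε)

namespace MinimalType

variable {n : ℕ} {p : ℝ → ℝ}

instance : AddCommGroup (MinimalType n p) :=
  inferInstanceAs (AddCommGroup ↥(⨅ ε : Set.Ioi (0 : ℝ), growthSpace n p ε))

instance : Module ℂ (MinimalType n p) :=
  inferInstanceAs (Module ℂ ↥(⨅ ε : Set.Ioi (0 : ℝ), growthSpace n p ε))

/-- The underlying function of an element of `A_{p,+0}`, as a linear map. -/
def toFunₗ : MinimalType n p →ₗ[ℂ] (Cn n → ℂ) :=
  (⨅ ε : Set.Ioi (0 : ℝ), growthSpace n p ε).subtype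

instance : CoeFun (MinimalType n p) (fun _ => Cn n → ℂ) := ⟨fun f => toFunₗ f⟩

theorem mem_growthSpace (f : MinimalType n p) (ε : Set.Ioi (0 : ℝ)) :
    (f : Cn n → ℂ) ∈ growthSpace n p ε :=
  (Submodule.mem_iInf _).1 (Subtype.property f) ε

/-- The norms `‖·‖_{p,ε}`, `ε > 0`, on `A_{p,+0}`. -/
def seminorms (n : ℕ) (p : ℝ → ℝ) :
    SeminormFamily ℂ (MinimalType n p) (Set.Ioi (0 : ℝ)) := fun ε =>
  Seminorm.of (fun f => (growthNorm p (ε : ℝ) (f : Cn n → ℂ)).toReal)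
    (fun f g => by
      rw [map_add, ← ENNReal.toReal_add (f.mem_growthSpace ε).2.ne (g.mem_growthSpace ε).2.ne]
      exact ENNReal.toReal_mono
        (ENNReal.add_lt_top.2 ⟨(f.mem_growthSpace ε).2, (g.mem_growthSpace ε).2⟩).ne
        (growthNorm_add_le _ _ _ _))
    (fun c f => by
      rw [map_smul, growthNorm_smul, ENNReal.toReal_mul, toReal_enorm])

/-- The projective limit topology on `A_{p,+0}`, that is, the locally convex topology defined by
the norms `‖·‖_{p,ε}`, `ε > 0`. -/
instance : TopologicalSpace (MinimalType n p) :=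
  (seminorms n p).moduleFilterBasis.topology

theorem withSeminorms (n : ℕ) (p : ℝ → ℝ) : WithSeminorms (seminorms n p) := ⟨rfl⟩

end MinimalType

/-! ### Differential operators of infinite order -/

/-- The partial derivative `∂f/∂z_i`. -/
def pderiv {n : ℕ} (i : Fin n) (f : Cn n → ℂ) : Cn n → ℂ :=
  fun z => fderiv ℂ f z (EuclideanSpace.single i 1)

/-- `∂^α f = ∂_1^{α_1} ⋯ ∂_n^{α_n} f` for a multi-index `α`. -/
def mderiv {n : ℕ} (α : Fin n → ℕ) (f : Cn n → ℂ) : Cn n → ℂ :=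
  (List.finRange n).foldr (fun i g => (pderiv i)^[α i] g) f

/-- The operators `P = ∑_α a_α(z) ∂^α`, identified with their families of coefficients
`(a_α)_α`, that have all `a_α ∈ A_{p₂}` and satisfy: for every `σ > 0` there are `lam, C > 0` with
`‖a_α‖_{p₂,σ} ≤ C (G_{|α|} / α!) lam^{|α|}` for all `α`. Here `G` belongs to the normalized
proximate order `q₁` for the order `ρ₁`. -/
def minimalOperators (n : ℕ) (q₁ : ℝ → ℝ) (ρ₁ : ℝ) (p₂ : ℝ → ℝ) :
    Set ((Fin n → ℕ) → (Cn n → ℂ)) :=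
  {a | (∀ α, a α ∈ normalType n p₂) ∧
    ∀ σ : ℝ, 0 < σ → ∃ lam : ℝ, 0 < lam ∧ ∃ C : ℝ, 0 < C ∧ ∀ α : Fin n → ℕ,
      growthNorm p₂ σ (a α) ≤ ENNReal.ofReal
        (C * (G q₁ ρ₁ (∑ i, α i) / ((∏ i, (α i).factorial : ℕ) : ℝ)) * lam ^ (∑ i, α i))}

/-- `g = P f = ∑_α a_α ∂^α f` for `P = ∑_α a_α ∂^α`: every term of the series lies in `A_{p₂,+0}`,
and the series converges to `g` (unconditionally) in the topology of `A_{p₂,+0}`. -/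
def HasValue {n : ℕ} {p₁ p₂ : ℝ → ℝ} (a : (Fin n → ℕ) → (Cn n → ℂ))
    (f : MinimalType n p₁) (g : MinimalType n p₂) : Prop :=
  ∃ t : (Fin n → ℕ) → MinimalType n p₂,
    (∀ α z, t α z = a α z * mderiv α f z) ∧ HasSum t g

end EntireGrowth

end

/-! Write e_{z,α}(w) = (w - z)^α / α!. The Taylor series ∑ ∂^α f(z) e_{z,α} of f about any centre z
converges to f in A_{p₁,+0} itself (`hasSum_taylor_minimalType`). Applying a continuous F and
evaluating at the centre gives (F f)(z) = ∑ F(e_{z,α})(z) ∂^α f(z), so F is the operator with symbol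
a_α(z) = F(e_{z,α})(z). No other symbol is possible: ∂^α e_{z,β}(z) = δ_{αβ}, so P e_{z,β} takes the
value a_β(z) at z.

Two estimates, pulling in opposite directions, show that the numbers G_k are the right weights. By
`exists_pow_le`, r^k is at most G_k exp(δ r^{p(r)}) up to a geometric factor; hence e_{z,α} has norm
at most C λ^{|α|} G_{|α|} / α! times exp(δ |z|^{p(|z|)}), and continuity of F turns this into the
bound on its symbol. By `exists_radii`, Cauchy's estimates with radii φ(M(k+1)), k = |α|, bound (G_k
/ α!) λ^k |∂^α f(z)| by C 2^{-k} ‖f‖_ε exp(σ |z|^{p(|z|)}). Here λ is arbitrary and only ε has to be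
small, which is harmless for functions of minimal type. This makes both the series P f and the
Taylor series absolutely convergent in every norm.

Both estimates rest on the logarithmic derivative of r^{p(r)} being asymptotic to ρ/r, so that
dilations act on r^{p(r)} almost as on a power. The relation r^{p₁(r)} = O(r^{p₂(r)}) converts
growth exp(ε |z|^{p₁}) into exp(σ |z|^{p₂}) once ε is small. -/

noncomputable section

namespace EntireGrowth

/-! ### Directional derivatives of entire functions of several variables -/

section SeveralVariables

variable {E : Type*} [NormedAddCommGroup E] [NormedSpace ℂ E]

/-- The directional derivative of `f` along `v`. -/
def dirDeriv (v : E) (f : E → ℂ) : E → ℂ := fun z => fderiv ℂ f z v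

theorem hasDerivAt_line {f : E → ℂ} (hf : Differentiable ℂ f) (z v : E) (t : ℂ) :
    HasDerivAt (fun t : ℂ => f (z + t • v)) (dirDeriv v f (z + t • v)) t := by
  have h1 : HasDerivAt (fun t : ℂ => z + t • v) v t := by
    simpa using ((hasDerivAt_id t).smul_const v).const_add z
  exact (hf (z + t • v)).hasFDerivAt.comp_hasDerivAt t h1

theorem differentiable_line {f : E → ℂ} (hf : Differentiable ℂ f) (z v : E) :
    Differentiable ℂ (fun t : ℂ => f (z + t • v)) := fun t =>
  (hasDerivAt_line hf z v t).differentiableAt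

/-- Cauchy's estimate for the Fréchet derivative. -/
theorem norm_fderiv_le_of_forall_mem_closedBall {f : E → ℂ} (hf : Differentiable ℂ f) {z : E}
    {r M : ℝ} (hr : 0 < r) (hM : ∀ w ∈ Metric.closedBall z r, ‖f w‖ ≤ M) :
    ‖fderiv ℂ f z‖ ≤ M / r := by
  have hM0 : 0 ≤ M := (norm_nonneg _).trans (hM z (Metric.mem_closedBall_self hr.le))
  refine ContinuousLinearMap.opNorm_le_bound _ (by positivity) fun v => ?_
  rcases eq_or_ne v 0 with rfl | hv
  · simp
  have hv' : 0 < ‖v‖ := norm_pos_iff.2 hv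
  have h := Complex.norm_deriv_le_of_forall_mem_sphere_norm_le (c := 0) (C := M)
    (div_pos hr hv') (differentiable_line hf z v).diffContOnCl fun t ht => hM _ <| by
      have : ‖t‖ = r / ‖v‖ := by simpa using ht
      simp [norm_smul, this, hv'.ne']
  rw [(hasDerivAt_line hf z v 0).deriv] at h
  simpa [dirDeriv, div_div_eq_mul_div, div_mul_eq_mul_div] using h

/-- Cauchy's formula on the line through z along v writes the derivative as a circle integral of
values of f, and this can be differentiated in z under the integral sign. -/
theorem differentiable_dirDeriv [FiniteDimensional ℂ E] {f : E → ℂ} (hf : Differentiable ℂ f)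
    (v : E) : Differentiable ℂ (dirDeriv v f) := by
  intro z₀
  have : ProperSpace E := FiniteDimensional.proper ℂ E
  have : SecondCountableTopology (E →L[ℂ] ℂ) := by
    have : ProperSpace (E →L[ℂ] ℂ) := FiniteDimensional.proper ℂ _
    infer_instance
  borelize E
  have hint : ∀ z, dirDeriv v f z = (2 * Real.pi * Complex.I : ℂ)⁻¹ •
      ∫ θ in (0 : ℝ)..2 * Real.pi, deriv (circleMap 0 1) θ •
        ((circleMap 0 1 θ - 0)⁻¹ ^ 2 • f (z + circleMap 0 1 θ • v)) := by
    intro z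
    have h := (differentiable_line hf z v).diffContOnCl (s := Metric.ball 0 1)
    have h2 := h.circleIntegral_one_div_sub_center_pow_smul one_pos 1
    rw [iteratedDeriv_one, (hasDerivAt_line hf z v 0).deriv] at h2
    simp only [circleIntegral] at h2
    simp only [one_div, zero_smul, add_zero, Nat.factorial_one, Nat.cast_one, div_one,
      Nat.reduceAdd] at h2
    simp only [inv_pow]
    rw [h2, inv_smul_smul₀ Complex.two_pi_I_ne_zero]
  rw [show dirDeriv v f = _ from funext hint]
  suffices h : DifferentiableAt ℂ (fun z => ∫ θ in (0 : ℝ)..2 * Real.pi, deriv (circleMap 0 1) θ •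
      ((circleMap 0 1 θ - 0)⁻¹ ^ 2 • f (z + circleMap 0 1 θ • v))) z₀ from
      h.const_smul ((2 * Real.pi * Complex.I : ℂ)⁻¹)
  -- The radius adds the unit ball in which z varies, the shift along v, and the unit radius used in
  -- Cauchy's estimate for `fderiv`.
  obtain ⟨M, hM⟩ := (isCompact_closedBall z₀ (1 + ‖v‖ + 1)).exists_bound_of_continuousOn
    hf.continuous.continuousOn
  have hM0 : 0 ≤ M := (norm_nonneg _).trans (hM z₀ (Metric.mem_closedBall_self (by positivity)))
  have hcont : ∀ z : E, Continuous fun θ : ℝ => z + circleMap 0 1 θ • v := fun z =>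
    continuous_const.add ((continuous_circleMap 0 1).smul continuous_const)
  have hcoef : Continuous fun θ : ℝ => deriv (circleMap 0 1) θ * (circleMap 0 1 θ - 0)⁻¹ ^ 2 := by
    simp only [deriv_circleMap]
    refine ((continuous_circleMap 0 1).mul continuous_const).mul
      (Continuous.pow (Continuous.inv₀ ?_ ?_) 2)
    · exact (continuous_circleMap 0 1).sub continuous_const
    · intro θ; simp
  have hnorm : ∀ θ : ℝ, ‖deriv (circleMap 0 1) θ * (circleMap 0 1 θ - 0)⁻¹ ^ 2‖ = 1 := by
    intro θ; simp [deriv_circleMap]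
  refine (intervalIntegral.hasFDerivAt_integral_of_dominated_of_fderiv_le
    (F' := fun z θ => (deriv (circleMap 0 1) θ * (circleMap 0 1 θ - 0)⁻¹ ^ 2) •
      fderiv ℂ f (z + circleMap 0 1 θ • v)) (bound := fun _ => M / 1)
    (Metric.ball_mem_nhds z₀ one_pos) ?_ ?_ ?_ ?_ ?_ ?_).differentiableAt
  · refine Eventually.of_forall fun z => Continuous.aestronglyMeasurable ?_
    simp only [smul_eq_mul, ← mul_assoc]
    exact hcoef.mul (hf.continuous.comp (hcont z))
  · refine Continuous.intervalIntegrable ?_ _ _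
    simp only [smul_eq_mul, ← mul_assoc]
    exact hcoef.mul (hf.continuous.comp (hcont z₀))
  · refine MeasureTheory.AEStronglyMeasurable.smul hcoef.aestronglyMeasurable ?_
    exact ((measurable_fderiv ℂ f).comp (hcont z₀).measurable).aestronglyMeasurable
  · refine Eventually.of_forall fun θ _ z hz => ?_
    rw [norm_smul, hnorm, one_mul]
    refine norm_fderiv_le_of_forall_mem_closedBall hf one_pos fun w hw => hM w ?_
    have h1 : dist (z + circleMap 0 1 θ • v) z = ‖v‖ := by simp [dist_eq_norm, norm_smul]
    have h2 := dist_triangle4 w (z + circleMap 0 1 θ • v) z z₀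
    rw [Metric.mem_ball] at hz
    rw [Metric.mem_closedBall] at hw ⊢
    linarith
  · exact intervalIntegrable_const
  · refine Eventually.of_forall fun θ _ z _ => ?_
    simp only [smul_smul, ← smul_eq_mul (a := deriv _ _)]
    refine HasFDerivAt.fun_const_smul ?_ _
    exact (hasFDerivAt_comp_add_right _).2 (hf _).hasFDerivAt

theorem differentiable_iterate_dirDeriv [FiniteDimensional ℂ E] {f : E → ℂ}
    (hf : Differentiable ℂ f) (v : E) (k : ℕ) : Differentiable ℂ ((dirDeriv v)^[k] f) := by
  induction k with
  | zero => exact hf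
  | succ k ih =>
    rw [Function.iterate_succ_apply']
    exact differentiable_dirDeriv ih v

theorem iteratedDeriv_line [FiniteDimensional ℂ E] {f : E → ℂ} (hf : Differentiable ℂ f)
    (z v : E) (k : ℕ) :
    iteratedDeriv k (fun t : ℂ => f (z + t • v)) = fun t => (dirDeriv v)^[k] f (z + t • v) := by
  induction k with
  | zero => simp
  | succ k ih =>
    rw [iteratedDeriv_succ, ih]
    funext t
    rw [Function.iterate_succ_apply']
    exact (hasDerivAt_line (differentiable_iterate_dirDeriv hf v k) z v t).deriv

/-- One-variable Cauchy estimate on the line through z; since ‖v‖ ≤ 1, the circle of radius s stays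
in the ball. -/
theorem norm_iterate_dirDeriv_le [FiniteDimensional ℂ E] {f : E → ℂ} (hf : Differentiable ℂ f)
    {z v : E} (hv : ‖v‖ ≤ 1) {s M : ℝ} (hs : 0 < s) (k : ℕ)
    (hM : ∀ w ∈ Metric.closedBall z s, ‖f w‖ ≤ M) :
    ‖(dirDeriv v)^[k] f z‖ ≤ k.factorial / s ^ k * M := by
  have h := Complex.norm_iteratedDeriv_le_of_forall_mem_sphere_norm_le (c := 0) (C := M) k hs
    (differentiable_line hf z v).diffContOnCl fun t ht => hM _ <| by
      have : ‖t‖ = s := by simpa using ht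
      simpa [norm_smul, this] using mul_le_of_le_one_right hs.le hv
  rw [iteratedDeriv_line hf] at h
  simpa [div_mul_eq_mul_div] using h

/-! ### Mixed derivatives along a list of directions, and their Taylor series -/

variable {ι : Type*}

/-- The derivative `∏_{i ∈ l} ∂_{v i}^{α i} f`, the first member of `l` acting last. -/
def listDeriv (v : ι → E) (l : List ι) (α : ι → ℕ) (f : E → ℂ) : E → ℂ :=
  l.foldr (fun i g => (dirDeriv (v i))^[α i] g) f

theorem listDeriv_cons (v : ι → E) (i : ι) (l : List ι) (α : ι → ℕ) (f : E → ℂ) :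
    listDeriv v (i :: l) α f = (dirDeriv (v i))^[α i] (listDeriv v l α f) := rfl

variable [FiniteDimensional ℂ E]

theorem differentiable_listDeriv {f : E → ℂ} (hf : Differentiable ℂ f) (v : ι → E) (l : List ι)
    (α : ι → ℕ) : Differentiable ℂ (listDeriv v l α f) := by
  induction l with
  | nil => exact hf
  | cons i l ih => exact differentiable_iterate_dirDeriv ih _ _

theorem iterate_dirDeriv_add {f g : E → ℂ} (hf : Differentiable ℂ f) (hg : Differentiable ℂ g)
    (v : E) (k : ℕ) : (dirDeriv v)^[k] (f + g) = (dirDeriv v)^[k] f + (dirDeriv v)^[k] g := by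
  induction k with
  | zero => rfl
  | succ k ih =>
    simp only [Function.iterate_succ_apply', ih]
    funext z
    simp [dirDeriv, fderiv_add (differentiable_iterate_dirDeriv hf v k z)
      (differentiable_iterate_dirDeriv hg v k z)]

theorem iterate_dirDeriv_const_smul {f : E → ℂ} (hf : Differentiable ℂ f) (c : ℂ) (v : E) (k : ℕ) :
    (dirDeriv v)^[k] (c • f) = c • (dirDeriv v)^[k] f := by
  induction k with
  | zero => rfl
  | succ k ih =>
    simp only [Function.iterate_succ_apply', ih]
    funext z
    simp [dirDeriv, fderiv_const_smul (differentiable_iterate_dirDeriv hf v k z) c]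

theorem listDeriv_add {f g : E → ℂ} (hf : Differentiable ℂ f) (hg : Differentiable ℂ g)
    (v : ι → E) (l : List ι) (α : ι → ℕ) :
    listDeriv v l α (f + g) = listDeriv v l α f + listDeriv v l α g := by
  induction l with
  | nil => rfl
  | cons i l ih =>
    rw [listDeriv_cons, ih, iterate_dirDeriv_add (differentiable_listDeriv hf v l α)
      (differentiable_listDeriv hg v l α)]
    rfl

theorem listDeriv_const_smul {f : E → ℂ} (hf : Differentiable ℂ f) (c : ℂ) (v : ι → E)
    (l : List ι) (α : ι → ℕ) : listDeriv v l α (c • f) = c • listDeriv v l α f := by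
  induction l with
  | nil => rfl
  | cons i l ih =>
    rw [listDeriv_cons, ih, iterate_dirDeriv_const_smul (differentiable_listDeriv hf v l α)]
    rfl

/-- Cauchy's estimates for mixed derivatives. -/
theorem norm_listDeriv_le {f : E → ℂ} (hf : Differentiable ℂ f) {v : ι → E}
    (hv : ∀ i, ‖v i‖ ≤ 1) (l : List ι) (α : ι → ℕ) {s M : ℝ} (hs : 0 < s) (z : E)
    (hM : ∀ w ∈ Metric.closedBall z (l.length * s), ‖f w‖ ≤ M) :
    ‖listDeriv v l α f z‖ ≤ (l.map fun i => ((α i).factorial : ℝ) / s ^ α i).prod * M := by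
  induction l generalizing z with
  | nil => simpa using! hM z (by simp)
  | cons i l ih =>
    rw [listDeriv_cons, List.map_cons, List.prod_cons, mul_assoc]
    refine norm_iterate_dirDeriv_le (differentiable_listDeriv hf v l α) (hv i) hs _ fun w hw =>
      ih w fun w' hw' => hM w' ?_
    rw [Metric.mem_closedBall] at *
    have := dist_triangle w' w z
    push_cast [List.length_cons]
    linarith

omit [FiniteDimensional ℂ E] in
theorem listDeriv_map {κ : Type*} (v : ι → E) (e : κ → ι) (l : List κ) (α : ι → ℕ) (f : E → ℂ) :
    listDeriv v (l.map e) α f = listDeriv (v ∘ e) l (α ∘ e) f := by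
  simp [listDeriv, List.foldr_map]

theorem summable_pow_sum {r : ℝ} (h0 : 0 ≤ r) (h1 : r < 1) (m : ℕ) :
    Summable fun α : Fin m → ℕ => r ^ ∑ i, α i := by
  induction m with
  | zero => exact Summable.of_finite
  | succ m ih =>
    rw [← (Fin.consEquiv fun _ : Fin (m + 1) => ℕ).summable_iff]
    have := (summable_geometric_of_lt_one h0 h1).mul_of_nonneg ih (fun k => pow_nonneg h0 k)
      (fun α => pow_nonneg h0 _)
    refine this.congr fun x => ?_
    simp [Fin.consEquiv, Fin.sum_univ_succ, pow_add]

/-- Cauchy's estimates with a radius s at least twice every |h i| dominate the series by a multiple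
of ∑ 2^{-|α|}. -/
theorem summable_taylor {f : E → ℂ} (hf : Differentiable ℂ f) {m : ℕ} {v : Fin m → E}
    (hv : ∀ i, ‖v i‖ ≤ 1) (z : E) (h : Fin m → ℂ) :
    Summable fun α : Fin m → ℕ =>
      (∏ i, h i ^ α i / ((α i).factorial : ℂ)) * listDeriv v (List.finRange m) α f z := by
  have : ProperSpace E := FiniteDimensional.proper ℂ E
  obtain ⟨s, hs0, hs⟩ : ∃ s : ℝ, 0 < s ∧ ∀ i, ‖h i‖ ≤ s * (1 / 2) := by
    refine ⟨2 * (‖h‖ + 1), by positivity, fun i => ?_⟩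
    have := norm_le_pi_norm h i
    linarith
  obtain ⟨M, hM⟩ :=
    (isCompact_closedBall z ((List.finRange m).length * s)).exists_bound_of_continuousOn
      hf.continuous.continuousOn
  refine Summable.of_norm_bounded
    ((summable_pow_sum (by norm_num : (0 : ℝ) ≤ 1 / 2) (by norm_num) m).mul_right M) fun α => ?_
  have hM0 : 0 ≤ M := (norm_nonneg _).trans (hM z (Metric.mem_closedBall_self (by positivity)))
  have h1 := norm_listDeriv_le hf hv (List.finRange m) α hs0 z hM
  rw [← Fin.prod_univ_def] at h1
  calc ‖(∏ i, h i ^ α i / ((α i).factorial : ℂ)) * listDeriv v (List.finRange m) α f z‖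
      ≤ (∏ i, ‖h i‖ ^ α i / ((α i).factorial : ℝ)) *
        ((∏ i, ((α i).factorial : ℝ) / s ^ α i) * M) := by
        rw [norm_mul, norm_prod]
        simp only [norm_div, norm_pow, RCLike.norm_natCast]
        gcongr
    _ = (∏ i, (‖h i‖ / s) ^ α i) * M := by
        rw [← mul_assoc, ← Finset.prod_mul_distrib]
        congr 1
        refine Finset.prod_congr rfl fun i _ => ?_
        have : ((α i).factorial : ℝ) ≠ 0 := by positivity
        rw [div_pow]
        field_simp
    _ ≤ (1 / 2) ^ (∑ i, α i) * M := by
        rw [← Finset.prod_pow_eq_pow_sum]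
        refine mul_le_mul_of_nonneg_right (Finset.prod_le_prod (fun i _ => by positivity)
          fun i _ => pow_le_pow_left₀ (by positivity) ?_ _) hM0
        rw [div_le_iff₀' hs0]
        exact hs i

/-- The Taylor expansion of an entire function of several variables. -/
theorem hasSum_taylor {f : E → ℂ} (hf : Differentiable ℂ f) {m : ℕ} {v : Fin m → E}
    (hv : ∀ i, ‖v i‖ ≤ 1) (z : E) (h : Fin m → ℂ) :
    HasSum (fun α : Fin m → ℕ =>
      (∏ i, h i ^ α i / ((α i).factorial : ℂ)) * listDeriv v (List.finRange m) α f z)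
      (f (z + ∑ i, h i • v i)) := by
  induction m generalizing z with
  | zero =>
    convert! hasSum_unique (fun α : Fin 0 → ℕ =>
      (∏ i, h i ^ α i / ((α i).factorial : ℂ)) * listDeriv v (List.finRange 0) α f z) using 1
    simp [listDeriv]
  | succ m ih =>
    have hs := summable_taylor hf hv z h
    rw [← (Fin.consEquiv fun _ : Fin (m + 1) => ℕ).summable_iff,
      ← (Equiv.prodComm _ _).summable_iff] at hs
    have hterm : ∀ (α : Fin m → ℕ) (k : ℕ),
        (∏ i, h i ^ (Fin.cons k α : Fin (m + 1) → ℕ) i /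
          (((Fin.cons k α : Fin (m + 1) → ℕ) i).factorial : ℂ)) *
            listDeriv v (List.finRange (m + 1)) (Fin.cons k α) f z =
        (∏ i : Fin m, h i.succ ^ α i / ((α i).factorial : ℂ)) * ((k.factorial : ℂ)⁻¹ •
          (h 0 - 0) ^ k • iteratedDeriv k (fun t : ℂ =>
            listDeriv (v ∘ Fin.succ) (List.finRange m) α f (z + t • v 0)) 0) := by
      intro α k
      rw [Fin.prod_univ_succ, List.finRange_succ, listDeriv_cons, listDeriv_map,
        iteratedDeriv_line (differentiable_listDeriv hf _ _ _)]
      have : (Fin.cons k α : Fin (m + 1) → ℕ) ∘ Fin.succ = α := by ext i; simp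
      rw [this]
      simp only [Fin.cons_zero, Fin.cons_succ, smul_eq_mul, zero_smul, add_zero, sub_zero]
      ring
    -- Absolute convergence permits summing over the first exponent with the others fixed. That
    -- inner sum is the one-variable Taylor series, along `v 0`, of the derivative in the remaining
    -- directions; the induction hypothesis at the shifted point sums the rest.
    have hfib := hs.hasSum.prod_fiberwise (g := fun α : Fin m → ℕ =>
      (∏ i : Fin m, h i.succ ^ α i / ((α i).factorial : ℂ)) *
        listDeriv (v ∘ Fin.succ) (List.finRange m) α f (z + h 0 • v 0)) (fun α => by
      have h1 := (Complex.hasSum_taylorSeries_of_entire (differentiable_line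
        (differentiable_listDeriv hf (v ∘ Fin.succ) (List.finRange m) α) z (v 0)) 0 (h 0)).mul_left
          (∏ i : Fin m, h i.succ ^ α i / ((α i).factorial : ℂ))
      refine h1.congr_fun fun k => ?_
      exact hterm α k)
    have hih := ih (v := v ∘ Fin.succ) (fun i => hv _) (z + h 0 • v 0) (fun i => h i.succ)
    have hsum := hfib.unique hih
    have hs' := hs.hasSum
    rw [hsum, (Equiv.prodComm _ _).hasSum_iff, Equiv.hasSum_iff] at hs'
    rw [Fin.sum_univ_succ, ← add_assoc]
    exact hs'

end SeveralVariables

/-! ### Growth of `r ^ p(r)` for a proximate order `p` -/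

namespace IsProximateOrder

variable {p : ℝ → ℝ} {ρ : ℝ}

/-- The function r^{p(r)} may be discontinuous at 0 if p(0) = 0, so base and exponent are bounded
separately. -/
theorem exists_bound (hp : IsProximateOrder p ρ) (R : ℝ) :
    ∃ B : ℝ, 0 ≤ B ∧ ∀ r, 0 ≤ r → r ≤ R → r ^ p r ≤ B := by
  obtain ⟨P, hP⟩ := (isCompact_Icc (a := 0) (b := R)).exists_bound_of_continuousOn
    (hp.differentiableOn.continuousOn.mono Set.Icc_subset_Ici_self)
  refine ⟨max 1 R ^ P, by positivity, fun r h0 hr => ?_⟩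
  calc r ^ p r ≤ max 1 R ^ p r :=
        Real.rpow_le_rpow h0 (hr.trans (le_max_right _ _)) (hp.nonneg r h0)
    _ ≤ max 1 R ^ P := Real.rpow_le_rpow_of_exponent_le (le_max_left _ _)
        ((le_abs_self _).trans (hP r ⟨h0, hr⟩))

/-- Two-sided bounds for the growth of `r ^ p(r)` under dilation. -/
theorem exists_rpow_bounds (hp : IsProximateOrder p ρ) (hρ : 0 < ρ) :
    ∃ R : ℝ, 1 < R ∧ ∀ r, R ≤ r → ∀ t, 1 ≤ t →
      t ^ (ρ / 2) * r ^ p r ≤ (t * r) ^ p (t * r) ∧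
      (t * r) ^ p (t * r) ≤ t ^ (2 * ρ) * r ^ p r := by
  -- Two errors of size ρ/4 keep r times the logarithmic derivative of r^{p(r)} between ρ/2 and 2ρ.
  -- Integrating, here in the form of two monotone functions, gives the bounds.
  have h1 : ∀ᶠ r in atTop, |deriv p r * r * Real.log r - 0| < ρ / 4 :=
    (Metric.tendsto_nhds.1 hp.tendsto_deriv) _ (by positivity)
  have h2 : ∀ᶠ r in atTop, |p r - ρ| < ρ / 4 := (Metric.tendsto_nhds.1 hp.tendsto) _ (by positivity)
  obtain ⟨R, hR⟩ := eventually_atTop.1 (h1.and (h2.and (eventually_gt_atTop 1)))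
  have hR1 : 1 < R := (hR R le_rfl).2.2
  have hd : ∀ r, R ≤ r → HasDerivAt (fun r => p r * Real.log r)
      (deriv p r * Real.log r + p r * r⁻¹) r := fun r hr => by
    have hr0 : 0 < r := by linarith
    exact ((hp.differentiableOn r hr0.le).differentiableAt (Ici_mem_nhds hr0)).hasDerivAt.mul
      (Real.hasDerivAt_log hr0.ne')
  have hb : ∀ r, R ≤ r → ρ / 2 * r⁻¹ ≤ deriv p r * Real.log r + p r * r⁻¹ ∧
      deriv p r * Real.log r + p r * r⁻¹ ≤ 2 * ρ * r⁻¹ := fun r hr => by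
    have hr0 : 0 < r := by linarith
    obtain ⟨ha, hb, -⟩ := hR r hr
    rw [abs_lt] at ha hb
    have : deriv p r * Real.log r + p r * r⁻¹ = (deriv p r * r * Real.log r + p r) * r⁻¹ := by
      field_simp
    rw [this]
    constructor <;> gcongr <;> linarith
  have hm1 : MonotoneOn (fun r => p r * Real.log r - ρ / 2 * Real.log r) (Set.Ici R) := by
    have hd' : ∀ r, R ≤ r → HasDerivAt (fun r => p r * Real.log r - ρ / 2 * Real.log r)
      (deriv p r * Real.log r + p r * r⁻¹ - ρ / 2 * r⁻¹) r := fun r hr =>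
        (hd r hr).sub ((Real.hasDerivAt_log (by linarith)).const_mul _)
    refine monotoneOn_of_deriv_nonneg (convex_Ici R)
      (fun r hr => (hd' r hr).continuousAt.continuousWithinAt)
      (fun r hr => (hd' r (interior_subset hr)).differentiableAt.differentiableWithinAt)
      fun r hr => ?_
    rw [(hd' r (interior_subset hr)).deriv]
    linarith [hb r (interior_subset hr)]
  have hm2 : MonotoneOn (fun r => 2 * ρ * Real.log r - p r * Real.log r) (Set.Ici R) := by
    have hd' : ∀ r, R ≤ r → HasDerivAt (fun r => 2 * ρ * Real.log r - p r * Real.log r)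
      (2 * ρ * r⁻¹ - (deriv p r * Real.log r + p r * r⁻¹)) r := fun r hr =>
        ((Real.hasDerivAt_log (by linarith)).const_mul _).sub (hd r hr)
    refine monotoneOn_of_deriv_nonneg (convex_Ici R)
      (fun r hr => (hd' r hr).continuousAt.continuousWithinAt)
      (fun r hr => (hd' r (interior_subset hr)).differentiableAt.differentiableWithinAt)
      fun r hr => ?_
    rw [(hd' r (interior_subset hr)).deriv]
    linarith [hb r (interior_subset hr)]
  refine ⟨R, hR1, fun r hr t ht => ?_⟩
  have hr0 : 0 < r := by linarith
  have ht0 : 0 < t := by linarith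
  have htr : r ≤ t * r := le_mul_of_one_le_left hr0.le ht
  have e1 := hm1 (Set.mem_Ici.2 hr) (Set.mem_Ici.2 (hr.trans htr)) htr
  have e2 := hm2 (Set.mem_Ici.2 hr) (Set.mem_Ici.2 (hr.trans htr)) htr
  simp only [Real.log_mul ht0.ne' hr0.ne'] at e1 e2
  simp only [Real.rpow_def_of_pos ht0, Real.rpow_def_of_pos hr0,
    Real.rpow_def_of_pos (mul_pos ht0 hr0), ← Real.exp_add, Real.exp_le_exp,
    Real.log_mul ht0.ne' hr0.ne']
  constructor <;> linarith

/-- `r ^ p₁(r) = O(r ^ p₂(r))` as a bound on all of `[0, ∞)`. -/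
theorem exists_le_mul_add {p₁ p₂ : ℝ → ℝ} {ρ₁ : ℝ} (hp₁ : IsProximateOrder p₁ ρ₁)
    (hO : (fun r : ℝ => r ^ p₁ r) =O[atTop] (fun r : ℝ => r ^ p₂ r)) :
    ∃ c B : ℝ, 0 ≤ c ∧ 0 ≤ B ∧ ∀ r, 0 ≤ r → r ^ p₁ r ≤ c * r ^ p₂ r + B := by
  obtain ⟨c, hc, h⟩ := hO.exists_pos
  obtain ⟨R, hR⟩ := eventually_atTop.1 h.bound
  obtain ⟨B, hB, hB'⟩ := hp₁.exists_bound R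
  refine ⟨c, B, hc.le, hB, fun r hr => ?_⟩
  have h2 : 0 ≤ c * r ^ p₂ r := mul_nonneg hc.le (Real.rpow_nonneg hr _)
  rcases le_total r R with h | h
  · linarith [hB' r hr h]
  · have := hR r h
    rw [Real.norm_of_nonneg (Real.rpow_nonneg hr _), Real.norm_of_nonneg (Real.rpow_nonneg hr _)]
      at this
    linarith

end IsProximateOrder

/-! ### Normalized orders: the inverse φ, dilations, and the numbers G_k -/

namespace IsNormalization

variable {q p : ℝ → ℝ} {ρ : ℝ}

theorem phi_pos (hq : IsNormalization q p ρ) {t : ℝ} (ht : 0 < t) : 0 < phi q t :=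
  Function.invFunOn_mem (f := fun r : ℝ => r ^ q r) (s := Set.Ioi 0) (b := t)
    (by have h : t ∈ Set.Ioi (0 : ℝ) := ht
        rwa [← hq.image_eq] at h)

theorem rpow_phi (hq : IsNormalization q p ρ) {t : ℝ} (ht : 0 < t) :
    phi q t ^ q (phi q t) = t :=
  Function.invFunOn_eq (f := fun r : ℝ => r ^ q r) (s := Set.Ioi 0) (b := t)
    (by have h : t ∈ Set.Ioi (0 : ℝ) := ht
        rwa [← hq.image_eq] at h)

theorem rpow_le_rpow (hq : IsNormalization q p ρ) {r s : ℝ} (hr : 0 < r) (hrs : r ≤ s) :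
    r ^ q r ≤ s ^ q s :=
  hq.strictMonoOn.monotoneOn hr (hr.trans_le hrs) hrs

theorem le_of_rpow_le (hq : IsNormalization q p ρ) {r s : ℝ} (hr : 0 < r) (hs : 0 < s)
    (h : r ^ q r ≤ s ^ q s) : r ≤ s :=
  (hq.strictMonoOn.le_iff_le hr hs).1 h

theorem phi_mono (hq : IsNormalization q p ρ) {s t : ℝ} (hs : 0 < s) (hst : s ≤ t) :
    phi q s ≤ phi q t :=
  hq.le_of_rpow_le (hq.phi_pos hs) (hq.phi_pos (hs.trans_le hst)) <| by
    rwa [hq.rpow_phi hs, hq.rpow_phi (hs.trans_le hst)]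

/-- `r ^ q(r)` grows at most by a constant factor under dilation, up to a constant. -/
theorem exists_dilation_le (hq : IsNormalization q p ρ) (hρ : 0 < ρ) {k : ℝ} (hk : 1 ≤ k) :
    ∃ K B : ℝ, 1 ≤ K ∧ 0 ≤ B ∧ ∀ r, 0 < r → (k * r) ^ q (k * r) ≤ K * r ^ q r + B := by
  obtain ⟨R, hR1, hR⟩ := hq.isProximateOrder.exists_rpow_bounds hρ
  have hR0 : 0 < R := by linarith
  refine ⟨k ^ (2 * ρ), (k * R) ^ q (k * R), Real.one_le_rpow hk (by positivity),
    Real.rpow_nonneg (by positivity) _, fun r hr => ?_⟩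
  rcases le_total R r with h | h
  · have := (hR r h k hk).2
    have h2 : 0 ≤ (k * R) ^ q (k * R) := Real.rpow_nonneg (by positivity) _
    linarith
  · have h1 : (k * r) ^ q (k * r) ≤ (k * R) ^ q (k * R) :=
      hq.rpow_le_rpow (by positivity) (by gcongr)
    have h2 : 0 ≤ k ^ (2 * ρ) * r ^ q r := by positivity
    linarith

/-- `r ^ q(r)` grows at least like a power under dilation. -/
theorem exists_le_dilation (hq : IsNormalization q p ρ) (hρ : 0 < ρ) {a : ℝ} (ha : 0 < a) :
    ∃ c : ℝ, 0 < c ∧ ∀ r, a ≤ r → ∀ t, 1 ≤ t →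
      c * t ^ (ρ / 2) * r ^ q r ≤ (t * r) ^ q (t * r) := by
  obtain ⟨R, hR1, hR⟩ := hq.isProximateOrder.exists_rpow_bounds hρ
  have hR0 : 0 < R := by linarith
  have hb0 : 0 < max a R := lt_max_of_lt_left ha
  have hu1 : a / max a R ≤ 1 := (div_le_one hb0).2 (le_max_left _ _)
  -- Only dilations starting beyond R are controlled. Starting at r ≥ a below R, one compares with a
  -- dilation of R, at the cost of a factor `a / max a R` in t.
  refine ⟨(a / max a R) ^ (ρ / 2), by positivity, fun r hr t ht => ?_⟩
  have hr0 : 0 < r := ha.trans_le hr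
  have ht0 : 0 < t := by linarith
  have hrq : 0 ≤ r ^ q r := Real.rpow_nonneg hr0.le _
  rw [← Real.mul_rpow (by positivity) ht0.le]
  rcases le_total R r with h | h
  · refine le_trans ?_ (hR r h t ht).1
    gcongr
    exact mul_le_of_le_one_left ht0.le hu1
  · rcases le_total R (t * r) with h' | h'
    · have h1 := (hR R le_rfl (t * r / R) ((one_le_div hR0).2 h')).1
      rw [div_mul_cancel₀ _ hR0.ne'] at h1
      refine le_trans ?_ h1
      have : a / max a R * t ≤ t * r / R := by
        rw [div_mul_eq_mul_div, mul_comm]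
        gcongr
        exact le_max_right _ _
      gcongr ?_ ^ _ * ?_
      exact hq.rpow_le_rpow hr0 h
    · have h1 : a / max a R * t ≤ 1 := by
        rw [div_mul_eq_mul_div, div_le_one hb0]
        calc a * t ≤ t * r := by rw [mul_comm]; gcongr
          _ ≤ max a R := h'.trans (le_max_right _ _)
      calc (a / max a R * t) ^ (ρ / 2) * r ^ q r ≤ 1 * r ^ q r := by
            gcongr
            exact Real.rpow_le_one (by positivity) h1 (by positivity)
        _ ≤ _ := by
            rw [one_mul]
            exact hq.rpow_le_rpow hr0 (le_mul_of_one_le_left hr0.le ht)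

/-- A proximate order and its normalization have boundedly different powers. -/
theorem exists_abs_sub_le (hq : IsNormalization q p ρ) (hp : IsProximateOrder p ρ) :
    ∃ B : ℝ, 0 ≤ B ∧ ∀ r, 0 ≤ r → r ^ p r ≤ r ^ q r + B ∧ r ^ q r ≤ r ^ p r + B := by
  obtain ⟨R, -, hR⟩ := hq.eventually_eq
  obtain ⟨B₁, h1, hB₁⟩ := hp.exists_bound R
  obtain ⟨B₂, h2, hB₂⟩ := hq.isProximateOrder.exists_bound R
  refine ⟨B₁ + B₂, by positivity, fun r hr => ?_⟩
  have hp0 : 0 ≤ r ^ p r := Real.rpow_nonneg hr _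
  have hq0 : 0 ≤ r ^ q r := Real.rpow_nonneg hr _
  rcases le_total r R with h | h
  · have := hB₁ r hr h
    have := hB₂ r hr h
    constructor <;> linarith
  · rw [hR r h]
    constructor <;> linarith

/-- Dilating φ(t) by 1/η raises the value of r^{q(r)} from t to at most K t + B ≤ (K + B) t, so M =
K + B works. -/
theorem exists_phi_le_mul_phi (hq : IsNormalization q p ρ) (hρ : 0 < ρ) {η : ℝ} (h0 : 0 < η)
    (h1 : η ≤ 1) : ∃ M : ℝ, 1 ≤ M ∧ ∀ t, 1 ≤ t → phi q t ≤ η * phi q (M * t) := by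
  obtain ⟨K, B, hK, hB, h⟩ := hq.exists_dilation_le hρ ((one_le_inv₀ h0).2 h1)
  refine ⟨K + B, by linarith, fun t ht => ?_⟩
  have ht0 : 0 < t := by linarith
  have hMt : 0 < (K + B) * t := by positivity
  have h2 := h _ (hq.phi_pos ht0)
  rw [hq.rpow_phi ht0] at h2
  have h3 : η⁻¹ * phi q t ≤ phi q ((K + B) * t) := by
    refine hq.le_of_rpow_le (mul_pos (by positivity) (hq.phi_pos ht0)) (hq.phi_pos hMt) ?_
    rw [hq.rpow_phi hMt]
    nlinarith
  rwa [inv_mul_le_iff₀ h0] at h3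

theorem G_eq (q : ℝ → ℝ) (hρ : 0 < ρ) (k : ℕ) :
    G q ρ k = (phi q k * ((Real.exp 1 * ρ) ^ (1 / ρ))⁻¹) ^ k := by
  rw [G, mul_pow, inv_pow, ← Real.rpow_natCast (_ ^ (1 / ρ)), ← Real.rpow_mul (by positivity),
    one_div_mul_eq_div, div_eq_mul_inv]

theorem G_pos (hq : IsNormalization q p ρ) (hρ : 0 < ρ) (k : ℕ) : 0 < G q ρ k := by
  rcases Nat.eq_zero_or_pos k with rfl | hk
  · simp [G]
  · have := hq.phi_pos (t := k) (by exact_mod_cast hk)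
    rw [G]
    positivity

/-- Choice of the radii for Cauchy's estimates. -/
theorem exists_radii (hq : IsNormalization q p ρ) (hp : IsProximateOrder p ρ) (hρ : 0 < ρ)
    {lam : ℝ} (hlam : 0 < lam) {σ : ℝ} (hσ : 0 < σ) (n : ℕ) :
    ∃ ε : ℝ, 0 < ε ∧ ∃ C : ℝ, 0 < C ∧ ∃ s : ℕ → ℝ, (∀ k, 0 < s k) ∧
      ∀ k r r', 0 ≤ r → 0 ≤ r' → r' ≤ r + n * s k →
        G q ρ k * lam ^ k / s k ^ k * Real.exp (ε * r' ^ p r') ≤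
          C * (1 / 2) ^ k * Real.exp (σ * r ^ p r) := by
  set κ : ℝ := ((Real.exp 1 * ρ) ^ (1 / ρ))⁻¹ with hκ
  have hκ0 : 0 < κ := by positivity
  -- This η makes φ(k) κ λ / s_k ≤ 1/4 for s_k = φ(M(k+1)). The exponential will cost 2^{k+1},
  -- leaving 2 · 2^{-k}. Using k + 1 keeps the argument of φ positive at k = 0.
  obtain ⟨M, hM1, hM⟩ := hq.exists_phi_le_mul_phi hρ (η := min 1 (1 / (4 * (κ * lam))))
    (by positivity) (min_le_left _ _)
  have hM0 : 0 < M := by linarith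
  obtain ⟨K, B, hK, hB, hKB⟩ := hq.exists_dilation_le hρ (k := (n : ℝ) + 1) (by simp)
  obtain ⟨B', hB', hpq⟩ := hq.exists_abs_sub_le hp
  have hK0 : 0 < K := by linarith
  set ε : ℝ := min (σ / K) (Real.log 2 / (K * M)) with hε
  have hlog : 0 < Real.log 2 := Real.log_pos (by norm_num)
  have hε0 : 0 < ε := by positivity
  have hε1 : ε * K ≤ σ := by
    rw [← le_div_iff₀ hK0]; exact min_le_left _ _
  have hε2 : ε * (K * M) ≤ Real.log 2 := by
    rw [← le_div_iff₀ (by positivity)]; exact min_le_right _ _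
  have hs0 : ∀ k : ℕ, 0 < M * ((k : ℝ) + 1) := fun k => by positivity
  refine ⟨ε, hε0, 2 * Real.exp (ε * (B + 2 * B' + K * B' + 1)), by positivity,
    fun k => phi q (M * ((k : ℝ) + 1)), fun k => hq.phi_pos (hs0 k), fun k r r' hr hr' hrr' => ?_⟩
  have hsk : 0 < phi q (M * ((k : ℝ) + 1)) := hq.phi_pos (hs0 k)
  have hGk : G q ρ k * lam ^ k / phi q (M * ((k : ℝ) + 1)) ^ k ≤ (1 / 4) ^ k := by
    rw [G_eq q hρ, ← mul_pow, ← div_pow]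
    rcases Nat.eq_zero_or_pos k with rfl | hk
    · simp
    have hk0 : (0 : ℝ) < k := by exact_mod_cast hk
    have hphik := hq.phi_pos hk0
    refine pow_le_pow_left₀ (by positivity) ?_ _
    rw [div_le_iff₀ hsk]
    have h1 : phi q k ≤ 1 / (4 * (κ * lam)) * phi q (M * ((k : ℝ) + 1)) :=
      calc phi q k ≤ phi q (k + 1) := hq.phi_mono hk0 (by linarith)
        _ ≤ _ := hM _ (by linarith)
        _ ≤ _ := by gcongr; exact min_le_right _ _
    calc phi q k * κ * lam ≤ 1 / (4 * (κ * lam)) * phi q (M * ((k : ℝ) + 1)) * κ * lam := by gcongr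
      _ = 1 / 4 * phi q (M * ((k : ℝ) + 1)) := by field_simp
  have hexp : r' ^ p r' ≤ K * r ^ p r + K * (M * ((k : ℝ) + 1)) + (B + 2 * B' + K * B' + 1) := by
    have h1 := (hpq r' hr').1
    have h2 := (hpq r hr).2
    have hrp : 0 ≤ r ^ p r := Real.rpow_nonneg hr _
    -- Here r' ≤ (n+1) max(r, s_k), so one dilation suffices, with s_k contributing exactly M(k+1).
    -- The final 1 covers r' = 0, where the power can be 0^0.
    have hmax : r' ^ q r' ≤ K * (r ^ q r + M * ((k : ℝ) + 1)) + B + B' + 1 := by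
      rcases hr'.eq_or_lt with rfl | hr'0
      · have h3 : (0 : ℝ) ^ q 0 ≤ 1 := Real.zero_rpow_le_one _
        have h4 : 0 ≤ r ^ q r := Real.rpow_nonneg hr _
        have := hs0 k
        nlinarith [mul_nonneg hK0.le (add_nonneg h4 this.le)]
      · have h4 : 0 ≤ r ^ q r := Real.rpow_nonneg hr _
        rcases le_total r (phi q (M * ((k : ℝ) + 1))) with h | h
        · have h3 := hq.rpow_le_rpow hr'0 (s := (n + 1) * phi q (M * ((k : ℝ) + 1))) (by linarith)
          have h5 := hKB _ hsk
          rw [hq.rpow_phi (hs0 k)] at h5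
          nlinarith [mul_nonneg hK0.le h4]
        · have hr0 : 0 < r := hsk.trans_le h
          have h3 := hq.rpow_le_rpow hr'0 (s := (n + 1) * r) (by
            have : (n : ℝ) * phi q (M * ((k : ℝ) + 1)) ≤ n * r := by gcongr
            linarith)
          have h5 := hKB _ hr0
          nlinarith [mul_nonneg hK0.le (hs0 k).le]
    nlinarith [mul_le_mul_of_nonneg_left h2 hK0.le]
  calc G q ρ k * lam ^ k / phi q (M * ((k : ℝ) + 1)) ^ k * Real.exp (ε * r' ^ p r')
      ≤ (1 / 4) ^ k * Real.exp (σ * r ^ p r + Real.log 2 * ((k : ℝ) + 1) +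
          ε * (B + 2 * B' + K * B' + 1)) := by
        refine mul_le_mul hGk (Real.exp_le_exp.2 ?_) (Real.exp_nonneg _) (by positivity)
        have h1 := mul_le_mul_of_nonneg_left hexp hε0.le
        have h2 := mul_le_mul_of_nonneg_right hε1 (Real.rpow_nonneg hr (p r))
        have h3 := mul_le_mul_of_nonneg_right hε2 (by positivity : (0 : ℝ) ≤ (k : ℝ) + 1)
        linarith
    _ = 2 * Real.exp (ε * (B + 2 * B' + K * B' + 1)) * (1 / 2) ^ k * Real.exp (σ * r ^ p r) := by
        rw [Real.exp_add, Real.exp_add, Real.exp_mul (Real.log 2), Real.exp_log (by norm_num)]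
        rw [show (1 / 4 : ℝ) = 1 / 2 * (1 / 2) by norm_num, mul_pow,
          show ((k : ℝ) + 1) = ((k + 1 : ℕ) : ℝ) by push_cast; rfl, Real.rpow_natCast, pow_succ,
          one_div, inv_pow]
        have : (2 : ℝ) ^ k ≠ 0 := by positivity
        field_simp

/-- Powers are dominated by the numbers `G_k` and the growth function. -/
theorem exists_pow_le (hq : IsNormalization q p ρ) (hp : IsProximateOrder p ρ) (hρ : 0 < ρ)
    {δ : ℝ} (hδ : 0 < δ) :
    ∃ C : ℝ, 0 < C ∧ ∃ lam : ℝ, 0 < lam ∧ ∀ (k : ℕ) (r : ℝ), 0 ≤ r →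
      r ^ k ≤ C * lam ^ k * G q ρ k * Real.exp (δ * r ^ p r) := by
  obtain ⟨c, hc, hcb⟩ := hq.exists_le_dilation hρ (hq.phi_pos one_pos)
  obtain ⟨B, hB, hpq⟩ := hq.exists_abs_sub_le hp
  set A : ℝ := (Real.exp 1 * ρ) ^ (1 / ρ) with hA
  have hA0 : 0 < A := by positivity
  set b : ℝ := δ * c * (ρ / 2) with hb
  have hb0 : 0 < b := by positivity
  set L : ℝ := max 1 ((b ^ (2 / ρ))⁻¹) with hL
  have hL0 : 0 < L := by positivity
  refine ⟨Real.exp (δ * B), by positivity, A * L, by positivity, fun k r hr => ?_⟩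
  have hexp : Real.exp (δ * r ^ q r) ≤ Real.exp (δ * B) * Real.exp (δ * r ^ p r) := by
    rw [← Real.exp_add, Real.exp_le_exp]
    nlinarith [mul_le_mul_of_nonneg_left (hpq r hr).2 hδ.le]
  have hG := hq.G_pos hρ k
  suffices h : r ^ k ≤ (A * L) ^ k * G q ρ k * Real.exp (δ * r ^ q r) by
    calc r ^ k ≤ (A * L) ^ k * G q ρ k * Real.exp (δ * r ^ q r) := h
      _ ≤ (A * L) ^ k * G q ρ k * (Real.exp (δ * B) * Real.exp (δ * r ^ p r)) := by gcongr
      _ = _ := by ring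
  have hrq : 0 ≤ r ^ q r := Real.rpow_nonneg hr _
  rcases Nat.eq_zero_or_pos k with rfl | hk
  · simp only [pow_zero, G, one_mul, CharP.cast_eq_zero, zero_div, Real.rpow_zero, div_one]
    exact Real.one_le_exp (by positivity)
  have hk1 : (1 : ℝ) ≤ k := by exact_mod_cast hk
  have hk0 : (0 : ℝ) < k := by linarith
  have hphi := hq.phi_pos hk0
  have hAG : (A * L) ^ k * G q ρ k = (phi q k * L) ^ k := by
    rw [G_eq q hρ, ← mul_pow, ← hA]
    congr 1
    field_simp
  rw [hAG]
  rcases le_total r (phi q k) with h | h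
  · calc r ^ k ≤ (phi q k * L) ^ k := pow_le_pow_left₀ hr
          (h.trans (le_mul_of_one_le_right hphi.le (le_max_left _ _))) _
      _ ≤ _ := le_mul_of_one_le_right (by positivity) (Real.one_le_exp (by positivity))
  · set t : ℝ := r / phi q k with ht
    have ht1 : 1 ≤ t := (one_le_div hphi).2 h
    have ht0 : 0 < t := by linarith
    have hrt : r = t * phi q k := by rw [ht, div_mul_cancel₀ _ hphi.ne']
    have h1 := hcb _ (hq.phi_mono one_pos hk1) t ht1
    rw [hq.rpow_phi hk0, ← hrt] at h1
    -- From x ≤ e^x with x = b t^{ρ/2}, raised to the power 2/ρ; b was chosen so that the exponent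
    -- becomes δ c t^{ρ/2}. The k-th power then fits under δ r^{q(r)} ≥ δ c t^{ρ/2} k, by `h1`.
    have h2 : t ≤ L * Real.exp (δ * (c * t ^ (ρ / 2))) := by
      have h3 : b * t ^ (ρ / 2) ≤ Real.exp (b * t ^ (ρ / 2)) := by
        linarith [Real.add_one_le_exp (b * t ^ (ρ / 2))]
      have h4 := Real.rpow_le_rpow (by positivity) h3 (by positivity : 0 ≤ 2 / ρ)
      rw [Real.mul_rpow (by positivity) (by positivity), ← Real.rpow_mul ht0.le,
        ← Real.exp_mul, show ρ / 2 * (2 / ρ) = 1 by field_simp, Real.rpow_one,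
        show b * t ^ (ρ / 2) * (2 / ρ) = δ * (c * t ^ (ρ / 2)) by rw [hb]; field_simp] at h4
      have hbp : 0 < b ^ (2 / ρ) := by positivity
      calc t ≤ (b ^ (2 / ρ))⁻¹ * Real.exp (δ * (c * t ^ (ρ / 2))) := by
            rwa [← div_eq_inv_mul, le_div_iff₀' hbp]
        _ ≤ _ := by gcongr; exact le_max_right _ _
    calc r ^ k = (phi q k) ^ k * t ^ k := by rw [hrt]; ring
      _ ≤ (phi q k) ^ k * (L * Real.exp (δ * (c * t ^ (ρ / 2)))) ^ k := by gcongr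
      _ = (phi q k * L) ^ k * Real.exp (δ * (c * t ^ (ρ / 2) * k)) := by
          rw [mul_pow, mul_pow, ← Real.exp_nat_mul]; ring_nf
      _ ≤ _ := by gcongr

end IsNormalization

/-! ### Mixed partial derivatives on `ℂⁿ` -/

section MixedDerivatives

variable {n : ℕ}

theorem norm_single_one_le (i : Fin n) : ‖(EuclideanSpace.single i (1 : ℂ) : Cn n)‖ ≤ 1 := by
  simp

theorem differentiable_mderiv {f : Cn n → ℂ} (hf : Differentiable ℂ f) (α : Fin n → ℕ) :
    Differentiable ℂ (mderiv α f) :=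
  differentiable_listDeriv hf _ _ _

theorem mderiv_add {f g : Cn n → ℂ} (hf : Differentiable ℂ f) (hg : Differentiable ℂ g)
    (α : Fin n → ℕ) : mderiv α (f + g) = mderiv α f + mderiv α g :=
  listDeriv_add hf hg _ _ _

theorem mderiv_const_smul {f : Cn n → ℂ} (hf : Differentiable ℂ f) (c : ℂ) (α : Fin n → ℕ) :
    mderiv α (c • f) = c • mderiv α f :=
  listDeriv_const_smul hf c _ _ _

theorem norm_mderiv_le {f : Cn n → ℂ} (hf : Differentiable ℂ f) (α : Fin n → ℕ) {s M : ℝ}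
    (hs : 0 < s) (z : Cn n) (hM : ∀ w ∈ Metric.closedBall z (n * s), ‖f w‖ ≤ M) :
    ‖mderiv α f z‖ ≤ ((∏ i, (α i).factorial : ℕ) : ℝ) / s ^ (∑ i, α i) * M := by
  have h := norm_listDeriv_le hf norm_single_one_le (List.finRange n) α hs z
    (by simpa using hM)
  rw [← Fin.prod_univ_def, Finset.prod_div_distrib, Finset.prod_pow_eq_pow_sum] at h
  push_cast
  exact h

/-! ### Products of one-variable functions and centred monomials -/

/-- The divided power `t ↦ (t - c)^b / b!`. -/
def divPow (c : ℂ) (b : ℕ) : ℂ → ℂ := fun t => (t - c) ^ b / (b.factorial : ℂ)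

/-- The product `w ↦ ∏ⱼ gⱼ(wⱼ)`. -/
def coordProd (g : Fin n → ℂ → ℂ) : Cn n → ℂ := fun w => ∏ j, g j (w j)

/-- The monomial `w ↦ (w - z)^α / α!`. -/
def monomialAt (z : Cn n) (α : Fin n → ℕ) : Cn n → ℂ := coordProd fun j => divPow (z j) (α j)

theorem differentiable_divPow (c : ℂ) (b : ℕ) : Differentiable ℂ (divPow c b) := by
  unfold divPow; fun_prop

theorem deriv_divPow_zero (c : ℂ) : deriv (divPow c 0) = 0 := by
  have : divPow c 0 = fun _ => 1 := by funext t; simp [divPow]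
  rw [this]
  exact deriv_const' 1

theorem deriv_divPow_succ (c : ℂ) (b : ℕ) : deriv (divPow c (b + 1)) = divPow c b := by
  funext t
  have h := ((((hasDerivAt_id t).sub_const c).pow (b + 1)).div_const
    (((b + 1).factorial : ℕ) : ℂ)).deriv
  have hb : ((b : ℂ) + 1) ≠ 0 := by exact_mod_cast Nat.succ_ne_zero b
  have hb' : (b.factorial : ℂ) ≠ 0 := by exact_mod_cast Nat.factorial_ne_zero b
  refine Eq.trans h ?_
  simp only [divPow, Nat.factorial_succ, id]
  push_cast
  field_simp

theorem iterate_deriv_divPow_self (c : ℂ) (a b : ℕ) :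
    deriv^[a] (divPow c b) c = if a = b then 1 else 0 := by
  induction a generalizing b with
  | zero =>
    rcases b with _ | b
    · simp [divPow]
    · simp [divPow]
  | succ a ih =>
    rw [Function.iterate_succ_apply]
    rcases b with _ | b
    · rw [deriv_divPow_zero]
      have : ∀ k, deriv^[k] (0 : ℂ → ℂ) = 0 := fun k => by
        induction k with
        | zero => rfl
        | succ k ih => rw [Function.iterate_succ_apply', ih]; funext t; simp
      simp [this]
    · rw [deriv_divPow_succ, ih]
      simp

theorem differentiable_coordProd {g : Fin n → ℂ → ℂ} (hg : ∀ j, Differentiable ℂ (g j)) :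
    Differentiable ℂ (coordProd g) := by
  unfold coordProd
  exact fun w => (HasFDerivAt.finsetProd fun j _ => ((hg j).comp
    (EuclideanSpace.proj (𝕜 := ℂ) j).differentiable w).hasFDerivAt).differentiableAt

theorem differentiable_iterate_deriv {g : ℂ → ℂ} (hg : Differentiable ℂ g) (k : ℕ) :
    Differentiable ℂ (deriv^[k] g) := by
  rw [← iteratedDeriv_eq_iterate]
  exact hg.contDiff.differentiable_iteratedDeriv k (WithTop.coe_lt_top (k : ℕ∞))

theorem pderiv_coordProd {g : Fin n → ℂ → ℂ} (hg : ∀ j, Differentiable ℂ (g j)) (i : Fin n) :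
    pderiv i (coordProd g) = coordProd (Function.update g i (deriv (g i))) := by
  funext z
  have h1 := (hasDerivAt_line (differentiable_coordProd hg) z (EuclideanSpace.single i (1 : ℂ)) 0)
  have h2 : ∀ t : ℂ, coordProd g (z + t • EuclideanSpace.single i (1 : ℂ)) =
      g i (z i + t) * ∏ j ∈ Finset.univ.erase i, g j (z j) := fun t => by
    rw [coordProd, ← Finset.mul_prod_erase _ _ (Finset.mem_univ i)]
    congr 1
    · simp
    · refine Finset.prod_congr rfl fun j hj => ?_
      simp [Finset.ne_of_mem_erase hj]
  have h3 : HasDerivAt (fun t : ℂ => g i (z i + t) * ∏ j ∈ Finset.univ.erase i, g j (z j))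
      (deriv (g i) (z i + 0) * ∏ j ∈ Finset.univ.erase i, g j (z j)) 0 :=
    (HasDerivAt.comp_const_add (z i) 0 (hg i _).hasDerivAt).mul_const _
  rw [funext h2] at h1
  have h4 := h1.unique h3
  rw [zero_smul, add_zero, add_zero] at h4
  refine Eq.trans h4 ?_
  rw [coordProd, ← Finset.mul_prod_erase _ _ (Finset.mem_univ i), Function.update_self]
  congr 1
  refine Finset.prod_congr rfl fun j hj => ?_
  rw [Function.update_of_ne (Finset.ne_of_mem_erase hj)]

theorem iterate_pderiv_coordProd {g : Fin n → ℂ → ℂ} (hg : ∀ j, Differentiable ℂ (g j))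
    (i : Fin n) (k : ℕ) :
    (pderiv i)^[k] (coordProd g) = coordProd (Function.update g i (deriv^[k] (g i))) := by
  induction k with
  | zero => simp
  | succ k ih =>
    rw [Function.iterate_succ_apply', ih, pderiv_coordProd]
    · simp [Function.iterate_succ_apply' deriv]
    · intro j
      rcases eq_or_ne j i with rfl | hj
      · simpa using differentiable_iterate_deriv (hg j) k
      · simpa [hj] using hg j

theorem mderiv_coordProd {g : Fin n → ℂ → ℂ} (hg : ∀ j, Differentiable ℂ (g j))
    (α : Fin n → ℕ) : mderiv α (coordProd g) = coordProd fun j => deriv^[α j] (g j) := by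
  -- Without repetitions, the factor `g i` is still undifferentiated when `i` is reached.
  have key : ∀ l : List (Fin n), l.Nodup →
      l.foldr (fun i f => (pderiv i)^[α i] f) (coordProd g) =
        coordProd fun j => if j ∈ l then deriv^[α j] (g j) else g j := by
    intro l
    induction l with
    | nil => simp
    | cons i l ih =>
      intro hl
      rw [List.nodup_cons] at hl
      rw [List.foldr_cons, ih hl.2, iterate_pderiv_coordProd]
      · congr 1
        funext j
        rcases eq_or_ne j i with rfl | hj
        · simp [hl.1]
        · simp [hj]
      · intro j
        split_ifs
        · exact differentiable_iterate_deriv (hg j) _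
        · exact hg j
  rw [mderiv, key _ (List.nodup_finRange n)]
  simp

theorem differentiable_monomialAt (z : Cn n) (α : Fin n → ℕ) :
    Differentiable ℂ (monomialAt z α) :=
  differentiable_coordProd fun _ => differentiable_divPow _ _

/-- This duality at the centre lets an operator's coefficients be read off from its values on
monomials. -/
theorem mderiv_monomialAt_self (z : Cn n) (α β : Fin n → ℕ) :
    mderiv α (monomialAt z β) z = if α = β then 1 else 0 := by
  rw [monomialAt, mderiv_coordProd fun _ => differentiable_divPow _ _]
  simp only [coordProd, iterate_deriv_divPow_self]
  rw [Finset.prod_ite_zero]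
  simp [funext_iff]

theorem norm_monomialAt_le (z w : Cn n) (α : Fin n → ℕ) :
    ‖monomialAt z α w‖ ≤ ‖w - z‖ ^ (∑ i, α i) / ((∏ i, (α i).factorial : ℕ) : ℝ) := by
  simp only [monomialAt, coordProd, divPow, norm_prod, norm_div, norm_pow, RCLike.norm_natCast]
  rw [Finset.prod_div_distrib, ← Finset.prod_pow_eq_pow_sum]
  push_cast
  gcongr with i
  exact PiLp.norm_apply_le (w - z) i

/-- The expansion of `(w - z)^α / α!` in powers of `w`. -/
theorem monomialAt_eq_sum (z w : Cn n) (α : Fin n → ℕ) :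
    monomialAt z α w = ∑ γ ∈ Fintype.piFinset fun i => Finset.range (α i + 1),
      (∏ i, (-z i) ^ (α i - γ i) / ((α i - γ i).factorial : ℂ)) * monomialAt 0 γ w := by
  have h : ∀ i, divPow (z i) (α i) (w i) = ∑ k ∈ Finset.range (α i + 1),
      ((-z i) ^ (α i - k) / ((α i - k).factorial : ℂ)) * divPow 0 k (w i) := fun i => by
    rw [divPow, sub_eq_add_neg, add_pow, Finset.sum_div]
    refine Finset.sum_congr rfl fun k hk => ?_
    have hk' : k ≤ α i := Nat.lt_succ_iff.1 (Finset.mem_range.1 hk)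
    have h1 : ((α i).factorial : ℂ) ≠ 0 := by exact_mod_cast Nat.factorial_ne_zero _
    have h2 : (k.factorial : ℂ) ≠ 0 := by exact_mod_cast Nat.factorial_ne_zero _
    have h3 : ((α i - k).factorial : ℂ) ≠ 0 := by exact_mod_cast Nat.factorial_ne_zero _
    rw [Nat.cast_choose ℂ hk', divPow, sub_zero]
    field_simp
  simp only [monomialAt, coordProd, h, PiLp.zero_apply]
  rw [Finset.prod_univ_sum]
  exact Finset.sum_congr rfl fun γ _ => Finset.prod_mul_distrib

/-- The Taylor expansion of an entire function on `ℂⁿ`. -/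
theorem hasSum_monomialAt_mul_mderiv {f : Cn n → ℂ} (hf : Differentiable ℂ f) (z w : Cn n) :
    HasSum (fun α => monomialAt z α w * mderiv α f z) (f w) := by
  have h := hasSum_taylor hf norm_single_one_le z fun i => w i - z i
  have hw : z + ∑ i, (w i - z i) • EuclideanSpace.single i (1 : ℂ) = w := by
    ext j
    simp [Finset.sum_apply, Pi.single_apply]
  rw [hw] at h
  exact h

end MixedDerivatives

/-! ### Growth norms and the space of functions of minimal type -/

theorem growthNorm_le_ofReal_iff {n : ℕ} {p : ℝ → ℝ} {σ : ℝ} {f : Cn n → ℂ} {C : ℝ} (hC : 0 ≤ C) :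
    growthNorm p σ f ≤ ENNReal.ofReal C ↔
      ∀ z, ‖f z‖ ≤ C * Real.exp (σ * ‖z‖ ^ p ‖z‖) := by
  rw [growthNorm, iSup_le_iff]
  refine forall_congr' fun z => ?_
  rw [← ofReal_norm, ← ENNReal.ofReal_mul (norm_nonneg _), ENNReal.ofReal_le_ofReal_iff hC,
    Real.exp_neg, ← div_eq_mul_inv, div_le_iff₀ (Real.exp_pos _)]

theorem mem_growthSpace_of_bound {n : ℕ} {p : ℝ → ℝ} {σ : ℝ} {f : Cn n → ℂ}
    (hf : Differentiable ℂ f) {C : ℝ} (hC : 0 ≤ C)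
    (h : ∀ z, ‖f z‖ ≤ C * Real.exp (σ * ‖z‖ ^ p ‖z‖)) : f ∈ growthSpace n p σ :=
  ⟨hf, ((growthNorm_le_ofReal_iff hC).2 h).trans_lt ENNReal.ofReal_lt_top⟩

namespace MinimalType

variable {n : ℕ} {p : ℝ → ℝ}

/-- The index of the norm `‖·‖_{p,1}`. -/
abbrev indexOne : Set.Ioi (0 : ℝ) := ⟨1, Set.mem_Ioi.2 one_pos⟩

theorem toFun_injective : Function.Injective (toFunₗ : MinimalType n p →ₗ[ℂ] (Cn n → ℂ)) :=
  Subtype.val_injective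

theorem ext {f g : MinimalType n p} (h : ∀ z, f z = g z) : f = g :=
  toFun_injective (funext h)

theorem exists_of_bounds {f : Cn n → ℂ} (hf : Differentiable ℂ f)
    (h : ∀ ε : ℝ, 0 < ε → ∃ C : ℝ, 0 ≤ C ∧ ∀ z, ‖f z‖ ≤ C * Real.exp (ε * ‖z‖ ^ p ‖z‖)) :
    ∃ g : MinimalType n p, ∀ z, g z = f z :=
  ⟨⟨f, (Submodule.mem_iInf _).2 fun ε => by
    obtain ⟨C, hC, hb⟩ := h ε ε.2
    exact mem_growthSpace_of_bound hf hC hb⟩, fun _ => rfl⟩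

theorem differentiable (f : MinimalType n p) : Differentiable ℂ (f : Cn n → ℂ) :=
  (f.mem_growthSpace indexOne).1

theorem norm_le (f : MinimalType n p) (ε : Set.Ioi (0 : ℝ)) (z : Cn n) :
    ‖f z‖ ≤ seminorms n p ε f * Real.exp (ε * ‖z‖ ^ p ‖z‖) :=
  (growthNorm_le_ofReal_iff ENNReal.toReal_nonneg).1
    (ENNReal.ofReal_toReal (f.mem_growthSpace ε).2.ne).ge z

theorem seminorms_le {f : MinimalType n p} {ε : Set.Ioi (0 : ℝ)} {C : ℝ} (hC : 0 ≤ C)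
    (h : ∀ z, ‖f z‖ ≤ C * Real.exp (ε * ‖z‖ ^ p ‖z‖)) : seminorms n p ε f ≤ C :=
  ENNReal.toReal_le_of_le_ofReal hC ((growthNorm_le_ofReal_iff hC).2 h)

theorem seminorms_antitone (f : MinimalType n p) {ε δ : Set.Ioi (0 : ℝ)} (h : ε ≤ δ) :
    seminorms n p δ f ≤ seminorms n p ε f :=
  seminorms_le (apply_nonneg _ _) fun z => (f.norm_le ε z).trans <| by
    have : (0 : ℝ) ≤ ‖z‖ ^ p ‖z‖ := Real.rpow_nonneg (norm_nonneg _) _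
    have h' : (ε : ℝ) ≤ δ := h
    gcongr

/-- The norms decrease in ε, so a finite supremum of them is dominated by the one with the smallest
index. -/
theorem exists_le_seminorms (q : Seminorm ℂ (MinimalType n p)) (hq : Continuous q) :
    ∃ (ε : Set.Ioi (0 : ℝ)) (C : ℝ), 0 ≤ C ∧ ∀ f, q f ≤ C * seminorms n p ε f := by
  obtain ⟨s, C, -, h⟩ := Seminorm.bound_of_continuous (withSeminorms n p) q hq
  obtain ⟨ε, hε⟩ := s.bddBelow
  refine ⟨ε, C, C.2, fun f => (h f).trans ?_⟩
  rw [smul_apply, NNReal.smul_def, smul_eq_mul]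
  refine mul_le_mul_of_nonneg_left ?_ C.2
  exact Seminorm.finset_sup_apply_le (apply_nonneg _ _) fun δ hδ => f.seminorms_antitone (hε hδ)

theorem continuous_of_bound {p' : ℝ → ℝ} (T : MinimalType n p →ₗ[ℂ] MinimalType n p')
    (h : ∀ σ : Set.Ioi (0 : ℝ), ∃ (ε : Set.Ioi (0 : ℝ)) (C : ℝ),
      ∀ f, seminorms n p' σ (T f) ≤ C * seminorms n p ε f) : Continuous T := by
  refine (withSeminorms n p).continuous_of_isBounded (withSeminorms n p') T
    (Seminorm.IsBounded.of_real fun σ => ?_)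
  obtain ⟨ε, C, hC⟩ := h σ
  exact ⟨{ε}, C, fun f => by simpa using hC f⟩

theorem hasSum_apply {ι : Type*} {t : ι → MinimalType n p} {g : MinimalType n p} (h : HasSum t g)
    (z : Cn n) : HasSum (fun i => t i z) (g z) := by
  have hc : Continuous ((LinearMap.proj z).comp toFunₗ : MinimalType n p →ₗ[ℂ] ℂ) := by
    refine WithSeminorms.continuous_normedSpace_rng ℂ (withSeminorms n p) _
      ⟨{indexOne}, (Real.exp (1 * ‖z‖ ^ p ‖z‖)).toNNReal, fun f => ?_⟩
    rw [Finset.sup_singleton, smul_apply, NNReal.smul_def, smul_eq_mul,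
      Real.coe_toNNReal _ (Real.exp_nonneg _), mul_comm]
    exact f.norm_le indexOne z
  exact h.map _ hc

/-- The pointwise sum identifies g minus a partial sum with the tail, whose norm is at most the tail
of the series of norms. -/
theorem hasSum_of_summable_seminorms {ι : Type*} {t : ι → MinimalType n p} {g : MinimalType n p}
    (hs : ∀ ε, Summable fun i => seminorms n p ε (t i))
    (hg : ∀ z, HasSum (fun i => t i z) (g z)) : HasSum t g := by
  rw [HasSum, SummationFilter.unconditional_filter, (withSeminorms n p).tendsto_nhds]
  intro ε η hη
  filter_upwards [(tendsto_order.1 (tendsto_tsum_compl_atTop_zero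
    fun i => seminorms n p ε (t i))).2 η hη] with s hlt
  refine lt_of_le_of_lt (seminorms_le (tsum_nonneg fun i => apply_nonneg _ _) fun z => ?_) hlt
  have h1 := (hg z).summable.sum_add_tsum_subtype_compl s
  rw [(hg z).tsum_eq] at h1
  have h2 : (∑ i ∈ s, t i - g : MinimalType n p) z = -∑' i : { i // i ∉ s }, t i z := by
    rw [map_sub, map_sum, Pi.sub_apply, Finset.sum_apply, ← h1]
    ring
  rw [h2, norm_neg, ← tsum_mul_right]
  have hsub : Summable fun i : { i // i ∉ s } =>
      seminorms n p ε (t i) * Real.exp (ε * ‖z‖ ^ p ‖z‖) :=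
    ((hs ε).subtype (fun i => i ∉ s)).mul_right _
  exact tsum_of_norm_bounded hsub.hasSum fun i => (t i).norm_le ε z

/-- An absolutely summable family in `A_{p,+0}` has a sum. -/
theorem exists_hasSum_of_summable_seminorms {ρ : ℝ} (hp : IsProximateOrder p ρ) {ι : Type*}
    {t : ι → MinimalType n p} (hs : ∀ ε, Summable fun i => seminorms n p ε (t i)) :
    ∃ g : MinimalType n p, HasSum t g ∧
      ∀ ε, seminorms n p ε g ≤ ∑' i, seminorms n p ε (t i) := by
  have hbound : ∀ ε z, ‖∑' i, t i z‖ ≤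
      (∑' i, seminorms n p ε (t i)) * Real.exp (ε * ‖z‖ ^ p ‖z‖) := fun ε z => by
    rw [← tsum_mul_right]
    exact tsum_of_norm_bounded ((hs ε).mul_right _).hasSum fun i => (t i).norm_le ε z
  have hsum : ∀ z, Summable fun i => t i z := fun z =>
    Summable.of_norm_bounded ((hs indexOne).mul_right _) fun i => (t i).norm_le indexOne z
  -- The growth bounds control the terms on the ball of radius 2 about z₀; Cauchy's estimate then
  -- bounds their derivatives summably on the unit ball, so termwise differentiation applies.
  have hdiff : Differentiable ℂ fun z => ∑' i, t i z := fun z₀ => by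
    obtain ⟨B, hB0, hB⟩ := hp.exists_bound (‖z₀‖ + 2)
    have hu : Summable fun i => seminorms n p indexOne (t i) * Real.exp (1 * B) / 1 :=
      ((hs indexOne).mul_right _).div_const _
    refine (hasFDerivAt_tsum_of_isPreconnected hu Metric.isOpen_ball
      (convex_ball z₀ 1).isPreconnected (fun i z _ => ((t i).differentiable z).hasFDerivAt)
      (fun i z hz => norm_fderiv_le_of_forall_mem_closedBall (t i).differentiable one_pos
        fun w hw => ((t i).norm_le indexOne w).trans ?_)
      (Metric.mem_ball_self one_pos) (hsum z₀)
      (Metric.mem_ball_self one_pos)).differentiableAt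
    refine mul_le_mul_of_nonneg_left (Real.exp_le_exp.2 ?_) (apply_nonneg _ _)
    refine mul_le_mul_of_nonneg_left (hB _ (norm_nonneg _) ?_) zero_le_one
    rw [Metric.mem_closedBall] at hw
    rw [Metric.mem_ball] at hz
    have h1 := dist_triangle w z z₀
    have h2 := norm_le_norm_add_norm_sub' w z₀
    rw [dist_eq_norm w z₀] at h1
    linarith
  obtain ⟨g, hg⟩ := exists_of_bounds hdiff fun ε hε =>
    ⟨_, tsum_nonneg fun i => apply_nonneg (seminorms n p ⟨ε, hε⟩) (t i), hbound ⟨ε, hε⟩⟩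
  refine ⟨g, hasSum_of_summable_seminorms hs fun z => ?_, fun ε =>
    seminorms_le (tsum_nonneg fun i => apply_nonneg _ _) fun z => ?_⟩
  · rw [hg]
    exact (hsum z).hasSum
  · rw [hg]
    exact hbound ε z

end MinimalType

/-! ### Differential operators and continuous linear maps -/

section Operators

variable {n : ℕ} {p q : ℝ → ℝ} {ρ : ℝ}

/-- Cauchy's estimate with the radius s_k of `exists_radii`, k = |α|: the n coordinate steps stay
within distance n s_k of z, and α! cancels. -/
theorem exists_mderiv_bound (n : ℕ) (hq : IsNormalization q p ρ) (hp : IsProximateOrder p ρ)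
    (hρ : 0 < ρ) {lam : ℝ} (hlam : 0 < lam) {σ : ℝ} (hσ : 0 < σ) :
    ∃ (ε : Set.Ioi (0 : ℝ)) (C : ℝ), 0 ≤ C ∧ ∀ (α : Fin n → ℕ) (f : MinimalType n p) (z : Cn n),
      G q ρ (∑ i, α i) / ((∏ i, (α i).factorial : ℕ) : ℝ) * lam ^ (∑ i, α i) * ‖mderiv α f z‖ ≤
        C * (1 / 2) ^ (∑ i, α i) * MinimalType.seminorms n p ε f *
          Real.exp (σ * ‖z‖ ^ p ‖z‖) := by
  obtain ⟨ε, hε, C, hC, s, hs, h⟩ := hq.exists_radii hp hρ hlam hσ n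
  refine ⟨⟨ε, hε⟩, C, hC.le, fun α f z => ?_⟩
  set k := ∑ i, α i with hk
  have hfac : (0 : ℝ) < ((∏ i, (α i).factorial : ℕ) : ℝ) := by
    exact_mod_cast Finset.prod_pos fun i _ => Nat.factorial_pos _
  have hG := hq.G_pos hρ k
  have hsk := hs k
  set A : ℝ := G q ρ k * lam ^ k / s k ^ k with hA
  have hA0 : 0 < A := by positivity
  have hM := norm_mderiv_le f.differentiable α hsk z
    (M := MinimalType.seminorms n p ⟨ε, hε⟩ f *
      ((C * (1 / 2) ^ k * Real.exp (σ * ‖z‖ ^ p ‖z‖)) / A)) fun w hw => by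
    refine (f.norm_le ⟨ε, hε⟩ w).trans (mul_le_mul_of_nonneg_left ?_ (apply_nonneg _ _))
    rw [le_div_iff₀' hA0]
    refine h k ‖z‖ ‖w‖ (norm_nonneg _) (norm_nonneg _) ?_
    rw [Metric.mem_closedBall, dist_eq_norm] at hw
    linarith [norm_le_norm_add_norm_sub' w z]
  rw [← hk] at hM
  calc G q ρ k / ((∏ i, (α i).factorial : ℕ) : ℝ) * lam ^ k * ‖mderiv α f z‖
      ≤ G q ρ k / ((∏ i, (α i).factorial : ℕ) : ℝ) * lam ^ k *
        (((∏ i, (α i).factorial : ℕ) : ℝ) / s k ^ k * (MinimalType.seminorms n p ⟨ε, hε⟩ f *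
          ((C * (1 / 2) ^ k * Real.exp (σ * ‖z‖ ^ p ‖z‖)) / A))) := by gcongr
    _ = _ := by
        rw [hA]
        field_simp

/-- Since ‖w - z‖ ≤ 2 max(‖z‖, ‖w‖), the bound on powers is needed only for the larger norm; the
other exponential is at least 1. -/
theorem exists_monomialAt_bound (n : ℕ) (hq : IsNormalization q p ρ) (hp : IsProximateOrder p ρ)
    (hρ : 0 < ρ) {δ : ℝ} (hδ : 0 < δ) :
    ∃ C : ℝ, 0 < C ∧ ∃ lam : ℝ, 0 < lam ∧ ∀ (α : Fin n → ℕ) (z w : Cn n),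
      ‖monomialAt z α w‖ ≤
        C * (G q ρ (∑ i, α i) / ((∏ i, (α i).factorial : ℕ) : ℝ)) * lam ^ (∑ i, α i) *
          Real.exp (δ * ‖z‖ ^ p ‖z‖) * Real.exp (δ * ‖w‖ ^ p ‖w‖) := by
  obtain ⟨C, hC, lam, hlam, h⟩ := hq.exists_pow_le hp hρ hδ
  refine ⟨C, hC, 2 * lam, by positivity, fun α z w => (norm_monomialAt_le z w α).trans ?_⟩
  set k := ∑ i, α i
  have hfac : (0 : ℝ) < ((∏ i, (α i).factorial : ℕ) : ℝ) := by
    exact_mod_cast Finset.prod_pos fun i _ => Nat.factorial_pos _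
  have hG := hq.G_pos hρ k
  have he : ∀ z : Cn n, 1 ≤ Real.exp (δ * ‖z‖ ^ p ‖z‖) := fun z =>
    Real.one_le_exp (mul_nonneg hδ.le (Real.rpow_nonneg (norm_nonneg _) _))
  have hmax : max ‖z‖ ‖w‖ ^ k ≤ C * lam ^ k * G q ρ k *
      (Real.exp (δ * ‖z‖ ^ p ‖z‖) * Real.exp (δ * ‖w‖ ^ p ‖w‖)) := by
    rcases max_choice ‖z‖ ‖w‖ with hm | hm <;> rw [hm]
    · refine (h k ‖z‖ (norm_nonneg _)).trans ?_
      gcongr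
      exact le_mul_of_one_le_right (Real.exp_nonneg _) (he w)
    · refine (h k ‖w‖ (norm_nonneg _)).trans ?_
      gcongr
      exact le_mul_of_one_le_left (Real.exp_nonneg _) (he z)
  have hsub : ‖w - z‖ ≤ 2 * max ‖z‖ ‖w‖ := by
    linarith [norm_sub_le w z, le_max_left ‖z‖ ‖w‖, le_max_right ‖z‖ ‖w‖]
  calc ‖w - z‖ ^ k / ((∏ i, (α i).factorial : ℕ) : ℝ)
      ≤ (2 * max ‖z‖ ‖w‖) ^ k / ((∏ i, (α i).factorial : ℕ) : ℝ) := by gcongr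
    _ ≤ 2 ^ k * (C * lam ^ k * G q ρ k * (Real.exp (δ * ‖z‖ ^ p ‖z‖) *
          Real.exp (δ * ‖w‖ ^ p ‖w‖))) / ((∏ i, (α i).factorial : ℕ) : ℝ) := by
        rw [mul_pow]; gcongr
    _ = _ := by rw [mul_pow]; ring

/-- The monomials `(w - z)^α / α!` belong to `A_{p,+0}`. -/
theorem exists_minimalType_monomialAt (n : ℕ) (hq : IsNormalization q p ρ)
    (hp : IsProximateOrder p ρ) (hρ : 0 < ρ) :
    ∃ m : Cn n → (Fin n → ℕ) → MinimalType n p, ∀ z α w, m z α w = monomialAt z α w := by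
  have h : ∀ (z : Cn n) (α : Fin n → ℕ), ∃ m : MinimalType n p, ∀ w, m w = monomialAt z α w :=
    fun z α => MinimalType.exists_of_bounds (differentiable_monomialAt z α) fun ε hε => by
      obtain ⟨C, hC, lam, hlam, h⟩ := exists_monomialAt_bound n hq hp hρ hε
      have hG := hq.G_pos hρ (∑ i, α i)
      exact ⟨_, by positivity, fun w => h α z w⟩
  choose m hm using h
  exact ⟨m, hm⟩

theorem HasValue.hasSum {p₁ p₂ : ℝ → ℝ} {a : (Fin n → ℕ) → (Cn n → ℂ)} {f : MinimalType n p₁}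
    {g : MinimalType n p₂} (h : HasValue a f g) (z : Cn n) :
    HasSum (fun α => a α z * mderiv α f z) (g z) := by
  obtain ⟨t, ht, hs⟩ := h
  simpa only [ht] using MinimalType.hasSum_apply hs z

/-! ### From operators to continuous maps and back -/

variable {p₁ p₂ q₁ : ℝ → ℝ} {ρ₁ ρ₂ : ℝ}

theorem differentiable_of_mem_minimalOperators {a : (Fin n → ℕ) → (Cn n → ℂ)}
    (ha : a ∈ minimalOperators n q₁ ρ₁ p₂) (α : Fin n → ℕ) : Differentiable ℂ (a α) := by
  obtain ⟨σ, -, h⟩ := ha.1 α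
  exact h.1

/-- The terms of `P f` for an operator `P` of the class `D_{p₁ → p₂, 0}`. -/
theorem exists_term_bound (hρ₁ : 0 < ρ₁) (hp₁ : IsProximateOrder p₁ ρ₁)
    (hO : (fun r : ℝ => r ^ p₁ r) =O[atTop] (fun r : ℝ => r ^ p₂ r))
    (hq₁ : IsNormalization q₁ p₁ ρ₁) {a : (Fin n → ℕ) → (Cn n → ℂ)}
    (ha : a ∈ minimalOperators n q₁ ρ₁ p₂) {σ : ℝ} (hσ : 0 < σ) :
    ∃ (ε : Set.Ioi (0 : ℝ)) (C : ℝ), 0 ≤ C ∧ ∀ (α : Fin n → ℕ) (f : MinimalType n p₁) (z : Cn n),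
      ‖a α z * mderiv α f z‖ ≤ C * (1 / 2) ^ (∑ i, α i) * MinimalType.seminorms n p₁ ε f *
        Real.exp (σ * ‖z‖ ^ p₂ ‖z‖) := by
  -- Half of σ is spent on the coefficient and half on the derivative, whose growth in p₁ is
  -- converted to p₂ through c; c + 1 keeps the divisor positive.
  obtain ⟨lam, hlam, C₁, hC₁, h₁⟩ := ha.2 (σ / 2) (by positivity)
  obtain ⟨c, B, hc, hB, hV⟩ := hp₁.exists_le_mul_add hO
  obtain ⟨ε, C₂, hC₂, h₂⟩ := exists_mderiv_bound n hq₁ hp₁ hρ₁ hlam (σ := σ / 2 / (c + 1))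
    (by positivity)
  refine ⟨ε, C₁ * C₂ * Real.exp (σ / 2 / (c + 1) * B), by positivity, fun α f z => ?_⟩
  set k := ∑ i, α i
  have hG := hq₁.G_pos hρ₁ k
  have h3 := (growthNorm_le_ofReal_iff (by positivity)).1 (h₁ α) z
  have h4 := h₂ α f z
  have hVz := hV ‖z‖ (norm_nonneg _)
  have hV2 : 0 ≤ ‖z‖ ^ p₂ ‖z‖ := Real.rpow_nonneg (norm_nonneg _) _
  have hS : 0 ≤ MinimalType.seminorms n p₁ ε f := apply_nonneg _ _
  have hexp : σ / 2 / (c + 1) * ‖z‖ ^ p₁ ‖z‖ ≤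
      σ / 2 / (c + 1) * B + σ / 2 * ‖z‖ ^ p₂ ‖z‖ := by
    have h5 : σ / 2 / (c + 1) * (c + 1) = σ / 2 := by field_simp
    have h6 : 0 < σ / 2 / (c + 1) := by positivity
    calc σ / 2 / (c + 1) * ‖z‖ ^ p₁ ‖z‖ ≤ σ / 2 / (c + 1) * ((c + 1) * ‖z‖ ^ p₂ ‖z‖ + B) := by
          gcongr; linarith
      _ = σ / 2 / (c + 1) * B + (σ / 2 / (c + 1) * (c + 1)) * ‖z‖ ^ p₂ ‖z‖ := by ring
      _ = _ := by rw [h5]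
  rw [norm_mul]
  calc ‖a α z‖ * ‖mderiv α f z‖
      ≤ (C₁ * (G q₁ ρ₁ k / ((∏ i, (α i).factorial : ℕ) : ℝ)) * lam ^ k *
          Real.exp (σ / 2 * ‖z‖ ^ p₂ ‖z‖)) * ‖mderiv α f z‖ := by gcongr
    _ = C₁ * Real.exp (σ / 2 * ‖z‖ ^ p₂ ‖z‖) *
          (G q₁ ρ₁ k / ((∏ i, (α i).factorial : ℕ) : ℝ) * lam ^ k * ‖mderiv α f z‖) := by ring
    _ ≤ C₁ * Real.exp (σ / 2 * ‖z‖ ^ p₂ ‖z‖) * (C₂ * (1 / 2) ^ k *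
          MinimalType.seminorms n p₁ ε f *
            Real.exp (σ / 2 / (c + 1) * B + σ / 2 * ‖z‖ ^ p₂ ‖z‖)) := by
        refine mul_le_mul_of_nonneg_left (h4.trans ?_) (by positivity)
        gcongr
    _ = C₁ * C₂ * Real.exp (σ / 2 / (c + 1) * B) * (1 / 2) ^ k *
          MinimalType.seminorms n p₁ ε f *
            (Real.exp (σ / 2 * ‖z‖ ^ p₂ ‖z‖) * Real.exp (σ / 2 * ‖z‖ ^ p₂ ‖z‖)) := by
        rw [Real.exp_add]; ring
    _ = _ := by rw [← Real.exp_add]; ring_nf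

/-- Operators of the class `D_{p₁ → p₂, 0}` define continuous linear maps. -/
theorem exists_continuousLinearMap_hasValue (hρ₁ : 0 < ρ₁) (hp₁ : IsProximateOrder p₁ ρ₁)
    (hp₂ : IsProximateOrder p₂ ρ₂)
    (hO : (fun r : ℝ => r ^ p₁ r) =O[atTop] (fun r : ℝ => r ^ p₂ r))
    (hq₁ : IsNormalization q₁ p₁ ρ₁) {a : (Fin n → ℕ) → (Cn n → ℂ)}
    (ha : a ∈ minimalOperators n q₁ ρ₁ p₂) :
    ∃ T : MinimalType n p₁ →L[ℂ] MinimalType n p₂, ∀ f, HasValue a f (T f) := by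
  have hterm : ∀ (f : MinimalType n p₁) (α : Fin n → ℕ),
      ∃ t : MinimalType n p₂, ∀ z, t z = a α z * mderiv α f z := fun f α => by
    refine MinimalType.exists_of_bounds ((differentiable_of_mem_minimalOperators ha α).mul
      (differentiable_mderiv f.differentiable α)) fun σ hσ => ?_
    obtain ⟨ε, C, hC, h⟩ := exists_term_bound hρ₁ hp₁ hO hq₁ ha hσ
    have hS : 0 ≤ MinimalType.seminorms n p₁ ε f := apply_nonneg _ _
    exact ⟨_, by positivity, h α f⟩
  choose t ht using hterm
  have hbound : ∀ σ : Set.Ioi (0 : ℝ), ∃ (ε : Set.Ioi (0 : ℝ)) (C : ℝ), ∀ f α,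
      MinimalType.seminorms n p₂ σ (t f α) ≤
        (1 / 2) ^ (∑ i, α i) * (C * MinimalType.seminorms n p₁ ε f) := fun σ => by
    obtain ⟨ε, C, hC, h⟩ := exists_term_bound hρ₁ hp₁ hO hq₁ ha σ.2
    refine ⟨ε, C, fun f α => ?_⟩
    have hS : 0 ≤ MinimalType.seminorms n p₁ ε f := apply_nonneg _ _
    refine MinimalType.seminorms_le (by positivity) fun z => ?_
    rw [ht]
    refine (h α f z).trans_eq ?_
    ring
  have hgeom := summable_pow_sum (by norm_num : (0 : ℝ) ≤ 1 / 2) (by norm_num) n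
  have hsum : ∀ f σ, Summable fun α => MinimalType.seminorms n p₂ σ (t f α) := fun f σ => by
    obtain ⟨ε, C, h⟩ := hbound σ
    exact Summable.of_nonneg_of_le (fun α => apply_nonneg _ _) (h f) (hgeom.mul_right _)
  have hT := fun f : MinimalType n p₁ =>
    MinimalType.exists_hasSum_of_summable_seminorms hp₂ (hsum f)
  choose T hTs hTb using hT
  have hval : ∀ (f : MinimalType n p₁) (z : Cn n),
      HasSum (fun α => a α z * mderiv α f z) (T f z) := fun f z => by
    simpa only [ht] using MinimalType.hasSum_apply (hTs f) z
  let L : MinimalType n p₁ →ₗ[ℂ] MinimalType n p₂ :=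
    { toFun := T
      map_add' := fun f g => MinimalType.ext fun z => by
        refine (hval (f + g) z).unique ?_
        rw [map_add]
        refine ((hval f z).add (hval g z)).congr_fun fun α => ?_
        rw [mderiv_add f.differentiable g.differentiable, Pi.add_apply, mul_add]
      map_smul' := fun c f => MinimalType.ext fun z => by
        refine (hval (c • f) z).unique ?_
        rw [RingHom.id_apply, map_smul]
        refine ((hval f z).const_smul c).congr_fun fun α => ?_
        rw [mderiv_const_smul f.differentiable, Pi.smul_apply, smul_eq_mul, smul_eq_mul]
        ring }
  refine ⟨⟨L, MinimalType.continuous_of_bound L fun σ => ?_⟩, fun f => ⟨t f, ht f, hTs f⟩⟩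
  obtain ⟨ε, C, h⟩ := hbound σ
  refine ⟨ε, (∑' α : Fin n → ℕ, (1 / 2 : ℝ) ^ (∑ i, α i)) * C, fun f => (hTb f σ).trans ?_⟩
  rw [mul_assoc, ← tsum_mul_right]
  exact (hsum f σ).tsum_le_tsum (h f) (hgeom.mul_right _)

/-- The Taylor series of `f ∈ A_{p,+0}` at `z` converges to `f` in `A_{p,+0}`. -/
theorem hasSum_taylor_minimalType (hq : IsNormalization q p ρ) (hp : IsProximateOrder p ρ)
    (hρ : 0 < ρ) {m : Cn n → (Fin n → ℕ) → MinimalType n p}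
    (hm : ∀ z α w, m z α w = monomialAt z α w) (f : MinimalType n p) (z : Cn n) :
    HasSum (fun α => mderiv α f z • m z α) f := by
  refine MinimalType.hasSum_of_summable_seminorms (fun ε => ?_) fun w => ?_
  · obtain ⟨C, hC, lam, hlam, h⟩ := exists_monomialAt_bound n hq hp hρ ε.2
    -- The geometric factor λ of the monomials is absorbed here, since the derivative bound holds
    -- for every λ.
    obtain ⟨δ, C', hC', h'⟩ := exists_mderiv_bound n hq hp hρ hlam one_pos
    refine Summable.of_nonneg_of_le (fun α => apply_nonneg _ _) (fun α => ?_)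
      ((summable_pow_sum (by norm_num : (0 : ℝ) ≤ 1 / 2) (by norm_num) n).mul_right
        (C * Real.exp (ε * ‖z‖ ^ p ‖z‖) * C' * MinimalType.seminorms n p δ f *
          Real.exp (1 * ‖z‖ ^ p ‖z‖)))
    have hG := hq.G_pos hρ (∑ i, α i)
    have h1 : MinimalType.seminorms n p ε (m z α) ≤
        C * (G q ρ (∑ i, α i) / ((∏ i, (α i).factorial : ℕ) : ℝ)) * lam ^ (∑ i, α i) *
          Real.exp (ε * ‖z‖ ^ p ‖z‖) :=
      MinimalType.seminorms_le (by positivity) fun w => by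
        rw [hm]
        exact h α z w
    rw [map_smul_eq_mul]
    calc ‖mderiv α f z‖ * MinimalType.seminorms n p ε (m z α)
        ≤ ‖mderiv α f z‖ * (C * (G q ρ (∑ i, α i) / ((∏ i, (α i).factorial : ℕ) : ℝ)) *
          lam ^ (∑ i, α i) * Real.exp (ε * ‖z‖ ^ p ‖z‖)) := by gcongr
      _ = C * Real.exp (ε * ‖z‖ ^ p ‖z‖) * (G q ρ (∑ i, α i) /
          ((∏ i, (α i).factorial : ℕ) : ℝ) * lam ^ (∑ i, α i) * ‖mderiv α f z‖) := by ring
      _ ≤ C * Real.exp (ε * ‖z‖ ^ p ‖z‖) * (C' * (1 / 2) ^ (∑ i, α i) *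
          MinimalType.seminorms n p δ f * Real.exp (1 * ‖z‖ ^ p ‖z‖)) :=
        mul_le_mul_of_nonneg_left (h' α f z) (by positivity)
      _ = _ := by ring
  · refine (hasSum_monomialAt_mul_mderiv f.differentiable z w).congr_fun fun α => ?_
    rw [map_smul, Pi.smul_apply, hm, smul_eq_mul, mul_comm]

/-- The symbol of a continuous linear map belongs to the class `D_{p₁ → p₂, 0}`. -/
theorem symbol_mem_minimalOperators (hρ₁ : 0 < ρ₁) (hp₁ : IsProximateOrder p₁ ρ₁)
    (hO : (fun r : ℝ => r ^ p₁ r) =O[atTop] (fun r : ℝ => r ^ p₂ r))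
    (hq₁ : IsNormalization q₁ p₁ ρ₁) {m : Cn n → (Fin n → ℕ) → MinimalType n p₁}
    (hm : ∀ z α w, m z α w = monomialAt z α w) (F : MinimalType n p₁ →L[ℂ] MinimalType n p₂) :
    (fun α z => F (m z α) z) ∈ minimalOperators n q₁ ρ₁ p₂ := by
  -- The variable z is both centre and evaluation point. Expanding the monomial about 0 separates
  -- the roles: a finite sum of polynomials in z times fixed entire functions F(w^γ / γ!).
  have hdiff : ∀ α, Differentiable ℂ fun z => F (m z α) z := fun α => by
    have hexpand : ∀ z, F (m z α) z = ∑ γ ∈ Fintype.piFinset fun i => Finset.range (α i + 1),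
        (∏ i, (-z i) ^ (α i - γ i) / ((α i - γ i).factorial : ℂ)) * F (m 0 γ) z := fun z => by
      have : m z α = ∑ γ ∈ Fintype.piFinset fun i => Finset.range (α i + 1),
          (∏ i, (-z i) ^ (α i - γ i) / ((α i - γ i).factorial : ℂ)) • m 0 γ :=
        MinimalType.ext fun w => by
          rw [hm, monomialAt_eq_sum, map_sum, Finset.sum_apply]
          refine Finset.sum_congr rfl fun γ _ => ?_
          rw [map_smul, Pi.smul_apply, hm, smul_eq_mul]
      rw [this, map_sum, map_sum, Finset.sum_apply]
      refine Finset.sum_congr rfl fun γ _ => ?_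
      rw [map_smul, map_smul, Pi.smul_apply, smul_eq_mul]
    rw [funext hexpand]
    refine Differentiable.fun_sum fun γ _ => Differentiable.mul ?_ (F (m 0 γ)).differentiable
    exact differentiable_coordProd
      (g := fun i t => (-t) ^ (α i - γ i) / ((α i - γ i).factorial : ℂ))
      fun i => by fun_prop
  have hbound : ∀ σ : ℝ, 0 < σ → ∃ lam : ℝ, 0 < lam ∧ ∃ C : ℝ, 0 < C ∧ ∀ α : Fin n → ℕ,
      growthNorm p₂ σ (fun z => F (m z α) z) ≤ ENNReal.ofReal
        (C * (G q₁ ρ₁ (∑ i, α i) / ((∏ i, (α i).factorial : ℕ) : ℝ)) * lam ^ (∑ i, α i)) := by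
    intro σ hσ
    obtain ⟨c, B, hc, hB, hV⟩ := hp₁.exists_le_mul_add hO
    have hσ2 : 0 < σ / 2 := by positivity
    obtain ⟨ε, C₁, hC₁, h₁⟩ := MinimalType.exists_le_seminorms
      ((MinimalType.seminorms n p₂ ⟨σ / 2, hσ2⟩).comp (F : MinimalType n p₁ →ₗ[ℂ] MinimalType n p₂))
      (((MinimalType.withSeminorms n p₂).continuous_seminorm _).comp F.continuous)
    have hε : (0 : ℝ) < ε := ε.2
    -- The first bound makes the δ-norm dominate the ε-norm supplied by continuity; the second turns
    -- growth in the centre z into at most σ/2 times the p₂-power, up to a constant.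
    set δ : ℝ := min ε (σ / 2 / (c + 1)) with hδ
    have hδ0 : 0 < δ := by positivity
    obtain ⟨C₂, hC₂, lam, hlam, h₂⟩ := exists_monomialAt_bound n hq₁ hp₁ hρ₁ hδ0
    refine ⟨lam, hlam, (C₁ + 1) * C₂ * Real.exp (δ * B), by positivity, fun α => ?_⟩
    have hG := hq₁.G_pos hρ₁ (∑ i, α i)
    rw [growthNorm_le_ofReal_iff (by positivity)]
    intro z
    set D : ℝ := G q₁ ρ₁ (∑ i, α i) / ((∏ i, (α i).factorial : ℕ) : ℝ) with hD
    have hD0 : 0 ≤ D := by positivity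
    have h3 : MinimalType.seminorms n p₁ ε (m z α) ≤
        C₂ * D * lam ^ (∑ i, α i) * Real.exp (δ * ‖z‖ ^ p₁ ‖z‖) :=
      ((m z α).seminorms_antitone (ε := ⟨δ, hδ0⟩) (min_le_left _ _ : δ ≤ ε)).trans <|
        MinimalType.seminorms_le (by positivity) fun w => by
          rw [hm]
          exact h₂ α z w
    have hV2 : 0 ≤ ‖z‖ ^ p₂ ‖z‖ := Real.rpow_nonneg (norm_nonneg _) _
    have hexp : δ * ‖z‖ ^ p₁ ‖z‖ ≤ δ * B + σ / 2 * ‖z‖ ^ p₂ ‖z‖ := by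
      have h5 : δ * (c + 1) ≤ σ / 2 := by
        rw [← le_div_iff₀ (by positivity)]
        exact min_le_right _ _
      have h6 := mul_le_mul_of_nonneg_left (hV ‖z‖ (norm_nonneg _)) hδ0.le
      have h7 := mul_le_mul_of_nonneg_right h5 hV2
      nlinarith [mul_nonneg hδ0.le hV2]
    calc ‖F (m z α) z‖
        ≤ MinimalType.seminorms n p₂ ⟨σ / 2, hσ2⟩ (F (m z α)) *
            Real.exp (σ / 2 * ‖z‖ ^ p₂ ‖z‖) := (F (m z α)).norm_le ⟨σ / 2, hσ2⟩ z
      _ ≤ (C₁ * MinimalType.seminorms n p₁ ε (m z α)) * Real.exp (σ / 2 * ‖z‖ ^ p₂ ‖z‖) := by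
          gcongr
          exact h₁ (m z α)
      _ ≤ ((C₁ + 1) * (C₂ * D * lam ^ (∑ i, α i) *
            Real.exp (δ * B + σ / 2 * ‖z‖ ^ p₂ ‖z‖))) * Real.exp (σ / 2 * ‖z‖ ^ p₂ ‖z‖) := by
          refine mul_le_mul_of_nonneg_right (mul_le_mul (by linarith) (h3.trans ?_)
            (apply_nonneg _ _) (by positivity)) (Real.exp_nonneg _)
          gcongr
      _ = (C₁ + 1) * C₂ * Real.exp (δ * B) * D * lam ^ (∑ i, α i) *
            (Real.exp (σ / 2 * ‖z‖ ^ p₂ ‖z‖) * Real.exp (σ / 2 * ‖z‖ ^ p₂ ‖z‖)) := by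
          rw [Real.exp_add]; ring
      _ = _ := by rw [← Real.exp_add]; ring_nf
  refine ⟨fun α => ?_, hbound⟩
  obtain ⟨lam, -, C, -, h⟩ := hbound 1 one_pos
  exact ⟨1, one_pos, hdiff α, (h α).trans_lt ENNReal.ofReal_lt_top⟩

end Operators

end EntireGrowth

end

theorem theorem4p7 (n : ℕ) (p₁ p₂ q₁ : ℝ → ℝ) (ρ₁ ρ₂ : ℝ) (hρ₁ : 0 < ρ₁) (hρ₂ : 0 < ρ₂)
    (hp₁ : EntireGrowth.IsProximateOrder p₁ ρ₁) (hp₂ : EntireGrowth.IsProximateOrder p₂ ρ₂)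
    (hO : (fun r : ℝ => r ^ p₁ r) =O[Filter.atTop] (fun r : ℝ => r ^ p₂ r))
    (hq₁ : EntireGrowth.IsNormalization q₁ p₁ ρ₁) :
    (∀ P ∈ EntireGrowth.minimalOperators n q₁ ρ₁ p₂,
      ∃ T : EntireGrowth.MinimalType n p₁ →L[ℂ] EntireGrowth.MinimalType n p₂,
        ∀ f, EntireGrowth.HasValue P f (T f)) ∧
    (∀ F : EntireGrowth.MinimalType n p₁ →L[ℂ] EntireGrowth.MinimalType n p₂,
      ∃! P : (Fin n → ℕ) → (EntireGrowth.Cn n → ℂ),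
        P ∈ EntireGrowth.minimalOperators n q₁ ρ₁ p₂ ∧
          ∀ f, EntireGrowth.HasValue P f (F f)) := by
  refine ⟨fun P hP => EntireGrowth.exists_continuousLinearMap_hasValue hρ₁ hp₁ hp₂ hO hq₁ hP,
    fun F => ?_⟩
  obtain ⟨m, hm⟩ := EntireGrowth.exists_minimalType_monomialAt n hq₁ hp₁ hρ₁
  have hmem := EntireGrowth.symbol_mem_minimalOperators hρ₁ hp₁ hO hq₁ hm F
  refine ⟨fun α z => F (m z α) z, ⟨hmem, fun f => ?_⟩, fun P hP => ?_⟩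
  · obtain ⟨T, hT⟩ :=
      EntireGrowth.exists_continuousLinearMap_hasValue hρ₁ hp₁ hp₂ hO hq₁ hmem
    -- At each z, expand f about that same z, apply F termwise and evaluate at z: this is the series
    -- defining T f at z.
    have hTF : T f = F f := EntireGrowth.MinimalType.ext fun z => by
      refine ((hT f).hasSum z).unique ?_
      have h := EntireGrowth.MinimalType.hasSum_apply
        (F.hasSum (EntireGrowth.hasSum_taylor_minimalType hq₁ hp₁ hρ₁ hm f z)) z
      refine h.congr_fun fun α => ?_
      rw [map_smul, map_smul, Pi.smul_apply, smul_eq_mul, mul_comm]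
    exact hTF ▸ hT f
  · funext β z
    -- Testing on the monomial centred at z and evaluating at z leaves only the coefficient P β z.
    have h := (hP.2 (m z β)).hasSum z
    have hmf : (EntireGrowth.MinimalType.toFunₗ (m z β) : EntireGrowth.Cn n → ℂ) =
        EntireGrowth.monomialAt z β := funext (hm z β)
    simp only [hmf, EntireGrowth.mderiv_monomialAt_self] at h
    refine HasSum.unique ?_ h
    simpa using hasSum_single (f := fun α => P α z * if α = β then 1 else 0) β
      fun α hα => by simp [hα]
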